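/- Let $n\ge 1$ and $k\ge 0$ be integers with $2k+1\le n$. Consider the weights of type $D_n$ in coordinates $e_1,\dots,e_n$, with $\rho=(n-1,n-2,\dots,1,0)$ and Weyl group $W$ the group of signed permutations with an even number of sign changes; write $\mu+\rho\sim\nu+\rho$ if $\sigma(\mu+\rho)=\nu+\rho$ for some $\sigma\in W$. Work with formal linear combinations, over $\mathbb Z[q^{\pm1}]$, of symbols $C_\lambda$ ($\lambda$ a dominant integral weight), where for $n$ even $C_{2\omega_{n-1}}$ and $C_{2\omega_n}$ are the same symbol. For an arbitrary integral weight $\mu$ put $C_\mu=(-1)^{l(\sigma)}C_\lambda$ if $\sigma(\mu+\rho)=\lambda+\rho$ with $\sigma\in W$ and $\lambda$ dominant, and $C_\mu=0$ if $\mu+\rho$ is not regular. For $2h\le n$ put $\omega_{2h}:=e_1+\dots+e_{2h}$ (so this denotes $\omega_{n-1}+\omega_n$ if $n=2h+1$ and $2\omega_n$ if $n=2h$), and for $2h+1\le n$ put $\omega_1+\omega_{2h+1}:=2e_1+e_2+\dots+e_{2h+1}$; write $C_{h,n}$ and $C_{2|h,n}$ for the corresponding symbols. Let $R_i$ be the reduced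 form of the left-hand side of the minuscule recurrence of the weight $\lambda=\omega_1+\omega_{2i+1}$, for the minuscule coweight $\omega=e_1$, specialized at $q\mapsto -q$, $t\mapsto q^2$: that is, of $$\sum_{\nu\in W\lambda} C_\nu \sum_{\psi}\left(t^{-(\rho,\psi)}-q^{(\lambda,\omega)}t^{(\rho,\psi)}\right),$$ where $\psi$ runs over $\{w\omega : w\in W,\ w\lambda=\nu\}$. Let $\Lambda_{2|k}^{2|k,n}$ be the coefficient of $C_{2|k,n}$ in $R_k$. Let $\Theta(n,k,h)$ be the number of weights $\nu$ in the $W$-orbit of $\omega_{2k}$ in type $D_n$ with $\nu+\rho\sim\omega_{2h}+\rho$, put $\Phi(n,k,h)=\Theta(n-1,k,h)$, and define integers $E_h^{k,n}$ by $E_h^{k,n}=0$ for $h>k$, $E_k^{k,n}=1$, and $E_h^{k,n}=-\sum_{i=h+1}^{k}(-1)^{i-h}\Phi(n,i,h)E_i^{k,n}$ for $0\le h<k$, so that $\sum_{i=h}^k(-1)^{i-h}\Phi(n,i,h)E_i^{k,n}=0$ for $0\le h<k$. Put $$s(m,q)=\frac{1-q^{4m+2}}{q^{2m}}\quad(m\in\mathbb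 Z),\qquad d_{k,n}=s(k,q)+s(n-k-1,q).$$ Let $\Gamma_{2|h}^{2|k,n}$ and $\Gamma_h^{2|k,n}$ be the coefficients of $C_{2|h,n}$ and $C_{h,n}$ in $\sum_{i=0}^kE_i^{k,n}R_i$. Then $\Gamma_{2|h}^{2|k,n}=0$ for all $0\le h<k$. If $n=2k+1$, then $$\sum_{i=0}^k E_i^{k,n}R_i=\Lambda_{2|k}^{2|k,n}C_{2|k,n}+\Gamma_k^{2|k,n}C_{k,n}-\sum_{j=0}^{k-1}s(k-j,q)\,C_{j,n},$$ and if $n>2k+1$, then $$\sum_{i=0}^k E_i^{k,n}R_i=\Lambda_{2|k}^{2|k,n}C_{2|k,n}+\Gamma_{k+1}^{2|k,n}C_{k+1,n}+\Gamma_k^{2|k,n}C_{k,n}-\sum_{j=0}^{k-1}d_{k-j,n-2j}\,C_{j,n}.$$ -/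

import Mathlib

namespace TypeD

open scoped LaurentPolynomial

/-- Integral weights of `D_n`, in the coordinates `e_1, …, e_n` (the index `i : Fin n` stands for
`e_{i+1}`); the invariant form is the dot product. -/
abbrev Weight (n : ℕ) : Type := Fin n → ℤ

/-- A permutation of the coordinates together with a sign for each coordinate. -/
abbrev SignedPerm (n : ℕ) : Type := Equiv.Perm (Fin n) × (Fin n → ℤˣ)

/-- The linear action of a signed permutation on weights: `e_j ↦ ε_{σ j} e_{σ j}`. -/
def act {n : ℕ} (w : SignedPerm n) (x : Weight n) : Weight n :=
  fun i => (w.2 i : ℤ) * x (w.1.symm i)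

/-- The Weyl group of `D_n`: the signed permutations with an even number of sign changes. -/
def weylGroup (n : ℕ) : Finset (SignedPerm n) :=
  Finset.univ.filter fun w => ∏ i, w.2 i = 1

/-- `(-1)^{l(w)}`, the determinant of `w`. For `w` in the Weyl group of `D_n` the product of the
signs is `1`, so this is the signature of the underlying permutation. -/
def weylSign {n : ℕ} (w : SignedPerm n) : ℤ := (Equiv.Perm.sign w.1 : ℤˣ)

/-- The Weyl vector `(n-1, n-2, …, 1, 0)`, half the sum of the positive roots `e_i ± e_j`,
`i < j`. -/
def rho (n : ℕ) : Weight n := fun i => (n : ℤ) - 1 - (i : ℕ)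

/-- The minuscule coweight `e_1`. -/
def e1 (n : ℕ) : Weight n := fun i => if (i : ℕ) = 0 then 1 else 0

/-- Dominance: nonnegative pairing with all positive roots `e_i ± e_j`, `i < j`. -/
def Dominant {n : ℕ} (μ : Weight n) : Prop :=
  ∀ i j : Fin n, i < j → 0 ≤ μ i - μ j ∧ 0 ≤ μ i + μ j

/-- The Weyl group orbit of a weight. -/
def orbit {n : ℕ} (lam : Weight n) : Finset (Weight n) :=
  (weylGroup n).image fun w => act w lam

/-- `μ + ρ ∼ ν + ρ`: the weight `μ` is conjugated to `ν`. -/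
def Conjugated {n : ℕ} (μ ν : Weight n) : Prop :=
  ∃ w ∈ weylGroup n, act w (μ + rho n) = ν + rho n

/-- The weight `ω_{2h} = e_1 + ⋯ + e_{2h}` (which is `ω_{n-1} + ω_n` if `n = 2h + 1`, and is to be
read as `2ω_n` if `n = 2h`). Its symbol `C` is denoted `C_{h,n}`. -/
def wtOne (n h : ℕ) : Weight n := fun i => if (i : ℕ) < 2 * h then 1 else 0

/-- The weight `ω_1 + ω_{2h+1} = 2e_1 + e_2 + ⋯ + e_{2h+1}` (which is `ω_1 + ω_{n-1} + ω_n` if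
`n = 2h + 2`, and `ω_1 + 2ω_n` if `n = 2h + 1`). Its symbol `C` is denoted `C_{2|h,n}`. -/
def wtTwo (n h : ℕ) : Weight n := fun i =>
  if (i : ℕ) = 0 then 2 else if (i : ℕ) < 2 * h + 1 then 1 else 0

/-- The weight `2ω_{n-1} = e_1 + ⋯ + e_{n-1} - e_n`. -/
def twoOmegaPred (n : ℕ) : Weight n := fun i => if (i : ℕ) + 1 = n then -1 else 1

/-- The weight `2ω_n = e_1 + ⋯ + e_n`. -/
def twoOmegaLast (n : ℕ) : Weight n := fun _ => 1

/-- Formal linear combinations of the symbols `C_μ`, with `C_μ = Finsupp.single μ 1`. The value of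
a combination at `μ` is the coefficient of `C_μ`. -/
abbrev Comb (n : ℕ) (R : Type*) [CommRing R] : Type _ := Weight n →₀ R

open Classical in
/-- The symbol `C_μ` of a dominant weight `μ`. For `n` even, `C_{2ω_{n-1}}` and `C_{2ω_n}` are the
same symbol (both are written `C_{n/2}`). -/
noncomputable def symb (n : ℕ) (R : Type*) [CommRing R] (μ : Weight n) : Comb n R :=
  Finsupp.single (if Even n ∧ μ = twoOmegaPred n then twoOmegaLast n else μ) 1

open Classical in
/-- The reduced form of `C_μ` for an arbitrary weight `μ`: it is `(-1)^{l(w)} C_λ` if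
`w (μ + ρ) = λ + ρ` with `w` in the Weyl group and `λ` dominant (`w` and `λ` are then unique), and
`0` if there are no such `w`, `λ`, that is, if `μ + ρ` is not regular. -/
noncomputable def reduced (n : ℕ) (R : Type*) [CommRing R] (μ : Weight n) : Comb n R :=
  if h : ∃ p : SignedPerm n × Weight n,
      p.1 ∈ weylGroup n ∧ Dominant p.2 ∧ act p.1 (μ + rho n) = p.2 + rho n then
    weylSign h.choose.1 • symb n R h.choose.2
  else 0

/-- The coefficient of `C_ν`, `ν = w_i λ`, in the minuscule recurrence of the weight `λ` for the
coweight `ω = e_1`, namely `∑_ψ (t^{-(ρ, w_i ψ)} - q^{(λ, ω)} t^{(ρ, w_i ψ)})` with `ψ` running over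
the orbit of `ω` under the stabilizer of `λ`. The weights `w_i ψ` are exactly the weights `w ω`
with `w λ = ν`. -/
def minusculeCoeff {R : Type*} [CommRing R] (q t : Rˣ) {n : ℕ} (lam ν : Weight n) : R :=
  ∑ ψ ∈ ((weylGroup n).filter fun w => act w lam = ν).image (fun w => act w (e1 n)),
    (((t ^ (-(rho n ⬝ᵥ ψ)) : Rˣ) : R) - ((q ^ (lam ⬝ᵥ e1 n) * t ^ (rho n ⬝ᵥ ψ) : Rˣ) : R))

/-- The left-hand side of the minuscule recurrence of `λ` (whose right-hand side is `0`), in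
reduced form. -/
noncomputable def minusculeRecurrence {R : Type*} [CommRing R] (q t : Rˣ) {n : ℕ}
    (lam : Weight n) : Comb n R :=
  ∑ ν ∈ orbit lam, minusculeCoeff q t lam ν • reduced n R ν

/-- The variable `q`, as a unit of `ℤ[q, q⁻¹]`. -/
noncomputable def qUnit : ℤ[T;T⁻¹]ˣ where
  val := LaurentPolynomial.T 1
  inv := LaurentPolynomial.T (-1)
  val_inv := by rw [← LaurentPolynomial.T_add]; simp
  inv_val := by rw [← LaurentPolynomial.T_add]; simp

/-- `R_k`: the reduced minuscule recurrence of `ω_1 + ω_{2k+1}` in type `D_n`, specialized by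
`q → -q`, `t → q²`. -/
noncomputable def recTwo (n k : ℕ) : Comb n ℤ[T;T⁻¹] :=
  minusculeRecurrence (-qUnit) (qUnit ^ 2) (wtTwo n k)

open Classical in
/-- `Ω_h^{k,n}`: the weights in the orbit of `ω_{2k}` that are conjugated to `ω_{2h}`. -/
noncomputable def Omega (n k h : ℕ) : Finset (Weight n) :=
  (orbit (wtOne n k)).filter fun ν => Conjugated ν (wtOne n h)

/-- `Θ(n,k,h) = |Ω_h^{k,n}|`. -/
noncomputable def Theta (n k h : ℕ) : ℕ := (Omega n k h).card

/-- `Φ(n,k,h) = Θ(n-1,k,h)`. -/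
noncomputable def Phi (n k h : ℕ) : ℕ := Theta (n - 1) k h

/-- The integers `E_h^{k,n}`: `0` for `h > k`, `1` for `h = k`, and
`-∑_{i=h+1}^k (-1)^{i-h} Φ(n,i,h) E_i^{k,n}` for `h < k`. -/
noncomputable def E (n k h : ℕ) : ℤ :=
  if k < h then 0
  else if h = k then 1
  else -∑ i : Finset.Icc (h + 1) k, (-1) ^ ((i : ℕ) - h) * (Phi n i h : ℤ) * E n k i
termination_by k - h
decreasing_by
  have := Finset.mem_Icc.1 i.2
  omega

/-- `s(m,q) = (1 - q^{4m+2}) / q^{2m}`, for any integer `m`. -/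
noncomputable def s (m : ℤ) : ℤ[T;T⁻¹] :=
  (1 - LaurentPolynomial.T (4 * m + 2)) * LaurentPolynomial.T (-(2 * m))

/-- `d_{k,n} = s(k,q) + s(n-k-1,q)`. -/
noncomputable def d (k n : ℤ) : ℤ[T;T⁻¹] := s k + s (n - k - 1)

/-- The symbol `C_{h,n}`. -/
noncomputable def COne (n h : ℕ) : Comb n ℤ[T;T⁻¹] := symb n _ (wtOne n h)

/-- The symbol `C_{2|h,n}`. -/
noncomputable def CTwo (n h : ℕ) : Comb n ℤ[T;T⁻¹] := symb n _ (wtTwo n h)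

/-- `Λ_{2|h}^{2|k,n}`: the coefficient of `C_{2|h,n}` in `R_k`. -/
noncomputable def LambdaTwo (n k h : ℕ) : ℤ[T;T⁻¹] := recTwo n k (wtTwo n h)

/-- The combination `∑_{i=0}^k E_i^{k,n} R_i`. -/
noncomputable def combination (n k : ℕ) : Comb n ℤ[T;T⁻¹] :=
  ∑ i ∈ Finset.range (k + 1), E n k i • recTwo n i

/-- `Γ_{2|h}^{2|k,n}`: the coefficient of `C_{2|h,n}` in `∑_{i=0}^k E_i^{k,n} R_i`. -/
noncomputable def GammaTwo (n k h : ℕ) : ℤ[T;T⁻¹] := combination n k (wtTwo n h)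

/-- `Γ_h^{2|k,n}`: the coefficient of `C_{h,n}` in `∑_{i=0}^k E_i^{k,n} R_i`. -/
noncomputable def GammaOne (n k h : ℕ) : ℤ[T;T⁻¹] := combination n k (wtOne n h)

end TypeD

/-!
The Weyl group of type `D_n` acts on `μ + ρ` by permutations and sign changes, so, up to the sign of
the last coordinate, the symbol `C_μ` is the alternating product of the functions
`y ^ a + y ^ (-a)`, `a` running over the coordinates of `μ + ρ`. Accordingly `C_μ` is represented by
a wedge product of generators `gen a = gen (-a)` of an exterior algebra (`weightWedge`), and the
coefficient of a dominant symbol is the signature `kappa`, a determinant. A comparison of norms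
shows that the identification of `C_{2ω_{n-1}}` with `C_{2ω_n}` is the only place where the sign of
the last coordinate matters (`nonnegDominant_or_eq_twoOmegaPred`, `reduced_apply`).

In the recurrence `R_i` a weight with `±2` at a place where `ρ` has the coordinate `m` has the
coefficient `s(±m)`. Summing over all weights with coordinates `0`, `±1` and a single `±2`, with a
factor `v` for each `±1` and `1 + v ^ 2` for each `0`, gives the sum over the places `m` of the
product of the vectors `(1 + v ^ 2) e_l + v e_{l+1} + v e_{l-1}`, with the factor at `l = m`
replaced by `s(m) e_{m+2} + s(-m) e_{m-2}` (`shiftSum`). Because `s(-m) = -s(m-1)`, this sum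
satisfies a recursion in `n` that can be solved in closed form (`shiftSum_succ`, `shiftCoeff_zero`,
`exists_mul_shiftCoeff`); its coefficients in degree `2k` are the ones claimed.

It remains to see that the coefficient of `v ^ (2k)` is the combination `∑ E_i R_i`. That
coefficient is `∑ binom(n-1-2i, k-i) R_i`, up to a factor `2` which appears when the orbit under all
signed permutations splits into two Weyl group orbits (`sum_choose_mul_recTwo`). The same expansion
without the replaced factor, in rank `n - 1`, is the generating function of the exterior powers of
the `2(n-1)`-dimensional representation (`mulProd_succ`). Its coefficients give the relation which
defines the numbers `E`, so these are the binomial coefficients, up to the same factor `2`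
(`sum_choose_mul_Theta`, `mult_mul_E`). The sign `(-1) ^ (i - h)` is uniform because every
contribution to `Θ(N,i,h)` uses exactly `i - h` adjacent transpositions (`weightWedge_small`).
-/

namespace TypeD

open ExteriorAlgebra Polynomial

/-! ### Wedge products of generators -/

section Wedge

variable {B : Type*} [CommRing B]

/-- The generator of index `|a|` of the exterior algebra on generators indexed by `ℕ`. It stands for
the function `y ^ a + y ^ (-a)`. -/
noncomputable def gen (B : Type*) [CommRing B] (a : ℤ) : ExteriorAlgebra B (ℕ →₀ B) :=
  ι B (Finsupp.single a.natAbs 1)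

theorem gen_neg (a : ℤ) : gen B (-a) = gen B a := by simp [gen]

theorem gen_mul_self_mul (a : ℤ) (x : ExteriorAlgebra B (ℕ →₀ B)) :
    gen B a * (gen B a * x) = 0 := by
  rw [← mul_assoc, gen, ι_sq_zero, zero_mul]

theorem gen_mul_comm (a b : ℤ) (x : ExteriorAlgebra B (ℕ →₀ B)) :
    gen B a * (gen B b * x) = -(gen B b * (gen B a * x)) := by
  rw [← mul_assoc, ← mul_assoc, ← neg_mul, gen, gen,
    eq_neg_of_add_eq_zero_left (ι_add_mul_swap _ _)]

/-- The product of the generators of indices `n - 1, …, 1, 0`. -/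
noncomputable def fullWedge (B : Type*) [CommRing B] : ℕ → ExteriorAlgebra B (ℕ →₀ B)
  | 0 => 1
  | n + 1 => gen B n * fullWedge B n

/-- The product of the generators of indices `n, …, 1, 0`, in this order, without the generator of
index `n - j`. The value is `0` if `n < j`. -/
noncomputable def missWedge (B : Type*) [CommRing B] : ℕ → ℕ → ExteriorAlgebra B (ℕ →₀ B)
  | n, 0 => fullWedge B n
  | 0, _ + 1 => 0
  | n + 1, j + 1 => gen B (n + 1) * missWedge B n j

theorem gen_add_one_mul_missWedge (n j : ℕ) :
    gen B (n + 1) * missWedge B n j = missWedge B (n + 1) (j + 1) := by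
  rw [missWedge]

theorem gen_mul_missWedge_zero (n : ℕ) : gen B n * missWedge B n 0 = missWedge B (n + 1) 0 := by
  simp [missWedge, fullWedge]

theorem gen_mul_missWedge_succ (n j : ℕ) : gen B n * missWedge B n (j + 1) = 0 := by
  cases n with
  | zero => simp [missWedge]
  | succ n => rw [missWedge]; push_cast; rw [gen_mul_self_mul]

theorem gen_mul_missWedge_succ_zero (n : ℕ) : gen B n * missWedge B (n + 1) 0 = 0 := by
  simp only [missWedge, fullWedge]; rw [gen_mul_self_mul]

theorem gen_mul_missWedge_succ_one (n : ℕ) :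
    gen B n * missWedge B (n + 1) 1 = -missWedge B (n + 2) 0 := by
  simp only [missWedge, fullWedge]; rw [gen_mul_comm]; push_cast; rfl

theorem gen_mul_missWedge_succ_add_two (n j : ℕ) :
    gen B n * missWedge B (n + 1) (j + 2) = 0 := by
  rw [missWedge, gen_mul_comm, gen_mul_missWedge_succ]; simp

theorem gen_mul_missWedge_add_two (n j : ℕ) :
    gen B n * missWedge B (n + 2) j = if j = 2 then missWedge B (n + 3) 0 else 0 := by
  rcases j with _ | _ | j
  · simp only [missWedge, fullWedge]
    rw [gen_mul_comm, gen_mul_self_mul]; simp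
  · rw [← gen_add_one_mul_missWedge, gen_mul_comm, gen_mul_missWedge_succ_zero]; simp
  · rw [← gen_add_one_mul_missWedge, gen_mul_comm, ← gen_add_one_mul_missWedge,
      gen_mul_comm _ (n + 1)]
    rcases j with _ | j
    · rw [gen_mul_missWedge_zero]
      simp [missWedge, fullWedge, add_assoc, one_add_one_eq_two]
    · rw [gen_mul_missWedge_succ]; simp

/-- The image of the generator of index `n` under multiplication by
`(1 + v y) (1 + v y⁻¹) = 1 + v ^ 2 + v (y + y⁻¹)`. -/
noncomputable def mulGen (v : B) (n : ℤ) : ExteriorAlgebra B (ℕ →₀ B) :=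
  (1 + v ^ 2) • gen B n + v • gen B (n + 1) + v • gen B (n - 1)

/-- The combination `s n • e_{n+2} + s (-n) • e_{n-2}` of generators, where `s` is extended to
negative arguments by `s (-n) = -s (n - 1)`. -/
noncomputable def shiftGen (s : ℕ → B) : ℕ → ExteriorAlgebra B (ℕ →₀ B)
  | 0 => (2 * s 0) • gen B 2
  | n + 1 => s (n + 1) • gen B (n + 3) - s n • gen B (n - 1)

/-- The product of `mulGen v l` over `l = n - 1, …, 1, 0`. -/
noncomputable def mulProd (v : B) : ℕ → ExteriorAlgebra B (ℕ →₀ B)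
  | 0 => 1
  | n + 1 => mulGen v n * mulProd v n

/-- The sum, over the places `m < n`, of the product of `mulGen v l` over `l = n - 1, …, 1, 0` with
the factor `mulGen v m` replaced by `shiftGen s m`. -/
noncomputable def shiftSum (v : B) (s : ℕ → B) : ℕ → ExteriorAlgebra B (ℕ →₀ B)
  | 0 => 0
  | n + 1 => shiftGen s n * mulProd v n + mulGen v n * shiftSum v s n

/-- The closed form of `mulProd v n` for `0 < n`: it is the sum of the exterior powers of the
`2n`-dimensional representation, weighted by powers of `v`; the degrees `j` and `2n - j` give the
same symbol. For `n = 0` the value is `2`, which is what the recursion for `shiftSum` needs. -/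
noncomputable def extSum (v : B) (n : ℕ) : ExteriorAlgebra B (ℕ →₀ B) :=
  ∑ j ∈ Finset.range (n + 1), (v ^ j + v ^ (2 * n - j)) • missWedge B n j

theorem mulGen_mul_missWedge (v : B) (n j : ℕ) :
    mulGen v (n + 1 : ℕ) * missWedge B (n + 1) j = v • missWedge B (n + 2) (j + 1) +
      (if j = 0 then (1 + v ^ 2) • missWedge B (n + 2) 0
        else if j = 1 then -(v • missWedge B (n + 2) 0) else 0) := by
  have e2 : ((n + 1 : ℕ) : ℤ) - 1 = (n : ℤ) := by push_cast; ring
  rw [mulGen, e2]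
  simp only [add_mul, smul_mul_assoc]
  rw [gen_add_one_mul_missWedge]
  rcases j with _ | _ | j
  · rw [gen_mul_missWedge_zero, gen_mul_missWedge_succ_zero]
    simp only [smul_zero, add_zero, if_true]; exact add_comm _ _
  · rw [gen_mul_missWedge_succ, gen_mul_missWedge_succ_one]; simp
  · rw [gen_mul_missWedge_succ, gen_mul_missWedge_succ_add_two]; simp

theorem mulGen_mul_sum_missWedge (v : B) (n : ℕ) (c : ℕ → B) :
    mulGen v (n + 1 : ℕ) * ∑ j ∈ Finset.range (n + 2), c j • missWedge B (n + 1) j =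
      ∑ j ∈ Finset.range (n + 2), (v * c j) • missWedge B (n + 2) (j + 1) +
        ((1 + v ^ 2) * c 0 - v * c 1) • missWedge B (n + 2) 0 := by
  rw [Finset.mul_sum]
  simp only [mul_smul_comm, mulGen_mul_missWedge, smul_add, Finset.sum_add_distrib]
  congr 1
  · exact Finset.sum_congr rfl fun j _ => by rw [smul_smul, mul_comm]
  · rw [Finset.sum_range_succ', Finset.sum_range_succ', Finset.sum_eq_zero]
    · simp [smul_smul, sub_smul, mul_comm]; abel
    · intro j _; simp

theorem mulProd_succ (v : B) (n : ℕ) : mulProd v (n + 1) = extSum v (n + 1) := by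
  induction n with
  | zero =>
    simp [mulProd, extSum, Finset.sum_range_succ, missWedge, fullWedge, mulGen]
    rw [gen_neg 1, add_assoc, add_smul v v]
  | succ n ih =>
    rw [mulProd, ih, extSum, mulGen_mul_sum_missWedge, extSum, Finset.sum_range_succ' _ (n + 1 + 1)]
    congr 1
    · refine Finset.sum_congr rfl fun j hj => ?_
      rw [Finset.mem_range] at hj
      congr 1
      obtain ⟨r, hr⟩ : ∃ r, 2 * (n + 1) = j + r := ⟨2 * (n + 1) - j, by omega⟩
      rw [show 2 * (n + 1) - j = r by omega, show 2 * (n + 1 + 1) - (j + 1) = r + 1 by omega]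
      ring
    · congr 1
      rw [show 2 * (n + 1) - 0 = 2 * n + 2 by omega, show 2 * (n + 1) - 1 = 2 * n + 1 by omega,
        show 2 * (n + 1 + 1) - 0 = 2 * n + 4 by omega]
      ring

/-- The coefficient of the product of the generators `n + 1, …, 0` without `n + 1 - j` in
`shiftSum v s (n + 1)`, for `j ≤ n + 1`. For larger `j` the value has no meaning. -/
noncomputable def shiftCoeff (v : B) (s : ℕ → B) : ℕ → ℕ → B
  | 0, _ => 0
  | n + 1, 0 => (1 + v ^ 2) * shiftCoeff v s n 0 - v * shiftCoeff v s n 1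
      - s n * (v ^ 2 + v ^ (2 * n))
  | n + 1, 1 => v * shiftCoeff v s n 0 - s n * v * (1 + v ^ (2 * n))
  | n + 1, j + 2 => v * shiftCoeff v s n (j + 1) - s n * (1 + v ^ 2) * (v ^ j + v ^ (2 * n - j))

theorem gen_sub_one_mul_extSum (v : B) (n : ℕ) :
    gen B (n - 1) * extSum v (n + 1) = (v ^ 2 + v ^ (2 * n)) • missWedge B (n + 2) 0 := by
  rcases n with _ | n
  · have h : gen B ((0 : ℕ) - 1) = gen B (1 : ℕ) := by rw [← gen_neg]; simp
    rw [h, extSum, Finset.sum_range_succ, Finset.sum_range_one, mul_add, mul_smul_comm,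
      mul_smul_comm, gen_mul_missWedge_zero, gen_mul_missWedge_succ]
    simp [add_comm]
  · rw [show ((n + 1 : ℕ) : ℤ) - 1 = n by push_cast; ring, extSum, Finset.mul_sum]
    simp only [mul_smul_comm, gen_mul_missWedge_add_two, smul_ite, smul_zero]
    rw [Finset.sum_ite_eq' _ 2, if_pos (by simp), show 2 * (n + 1 + 1) - 2 = 2 * (n + 1) by omega]

theorem mulGen_mul_gen_mul_extSum (v : B) (n : ℕ) :
    mulGen v (n + 1 : ℕ) * (gen B (n + 2) * extSum v n) =
      -(∑ j ∈ Finset.range (n + 1),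
          ((1 + v ^ 2) * (v ^ j + v ^ (2 * n - j))) • missWedge B (n + 2) (j + 2) +
        (v * (1 + v ^ (2 * n))) • missWedge B (n + 2) 1) := by
  have h1 : gen B (n + 1) * extSum v n =
      ∑ j ∈ Finset.range (n + 1), (v ^ j + v ^ (2 * n - j)) • missWedge B (n + 1) (j + 1) := by
    simp only [extSum, Finset.mul_sum, mul_smul_comm, gen_add_one_mul_missWedge]
  have h2 : gen B n * extSum v n = (1 + v ^ (2 * n)) • missWedge B (n + 1) 0 := by
    rw [extSum, Finset.sum_range_succ', mul_add, Finset.mul_sum, Finset.sum_eq_zero, mul_smul_comm,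
      gen_mul_missWedge_zero]
    · simp
    · intro j _; rw [mul_smul_comm, gen_mul_missWedge_succ, smul_zero]
  have h3 : ∀ j, gen B (n + 2) * missWedge B (n + 1) j = missWedge B (n + 2) (j + 1) := by
    intro j
    rw [← gen_add_one_mul_missWedge (n + 1)]; push_cast; rw [add_assoc]; norm_num
  rw [mulGen, show ((n + 1 : ℕ) : ℤ) + 1 = n + 2 by push_cast; ring,
    show ((n + 1 : ℕ) : ℤ) - 1 = n by push_cast; ring]
  simp only [add_mul, smul_mul_assoc]
  rw [gen_mul_self_mul, gen_mul_comm, gen_mul_comm (n : ℤ), h2]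
  push_cast
  rw [h1]
  simp only [Finset.mul_sum, mul_smul_comm, h3, smul_neg, Finset.smul_sum, smul_smul, smul_zero,
    add_zero, neg_add]
  simp only [add_assoc, one_add_one_eq_two, zero_add, one_mul, add_mul]

/-- The closed form of the sum of all products with one factor replaced. The first part collects the
terms in the generators `n + 1, …, 0`; the second part collects the terms in which the largest
factor reaches the generator `n + 2`. -/
theorem shiftSum_succ (v : B) (s : ℕ → B) (n : ℕ) :
    shiftSum v s (n + 1) =
      ∑ j ∈ Finset.range (n + 2), shiftCoeff v s n j • missWedge B (n + 1) j +
        s n • (gen B (n + 2) * extSum v n) := by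
  induction n with
  | zero =>
    simp [shiftSum, shiftGen, shiftCoeff, extSum, mulProd, smul_smul, missWedge, fullWedge]
    ring_nf
  | succ n ih =>
    rw [shiftSum, mulProd_succ, ih, mul_add, mulGen_mul_sum_missWedge, mul_smul_comm,
      mulGen_mul_gen_mul_extSum, shiftGen, sub_mul, smul_mul_assoc, smul_mul_assoc,
      gen_sub_one_mul_extSum, Finset.sum_range_succ' _ (n + 1 + 1),
      Finset.sum_range_succ' _ (n + 1), Finset.sum_range_succ' _ (n + 1)]
    simp only [shiftCoeff, sub_smul, Finset.sum_sub_distrib, add_smul, smul_neg, smul_add,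
      Finset.smul_sum, smul_smul]
    push_cast
    have e3 : (n : ℤ) + 1 + 2 = n + 3 := by ring
    have e1 : (n : ℤ) + 1 - 1 + 1 = n + 1 := by ring
    simp only [e3, Nat.reduceAdd, add_assoc]
    simp only [mul_assoc]
    module
end Wedge

/-! ### Coefficients of the closed form -/

section Coefficients

/-- The recursion gives `B_{n+1} - B_n = v ^ 2 (B_n - B_{n-1}) + (s (n-1) - s n) (v ^ 2 + v ^ (2n))`
for `B_n = shiftCoeff v s n 0` and `1 ≤ n`. Together with `B_0` and `B_1` this determines `B_n`. -/
theorem shiftCoeff_zero {B : Type*} [CommRing B] (v : B) (s : ℕ → B) (n : ℕ) :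
    shiftCoeff v s n 0 = -∑ i ∈ Finset.range (n + 1), (s i + s (n - i)) * v ^ (2 * i) +
      s n * (1 + v ^ (2 * n)) := by
  induction n using Nat.twoStepInduction with
  | zero => simp [shiftCoeff]; ring
  | one =>
    simp [shiftCoeff, Finset.sum_range_succ]; ring
  | more n ih0 ih1 =>
    have key : ∀ m, ∑ i ∈ Finset.range (m + 1), (s i + s (m - i)) * v ^ (2 * i) =
        ∑ i ∈ Finset.range (m + 1), s i * v ^ (2 * i) +
          ∑ i ∈ Finset.range (m + 1), s i * v ^ (2 * (m - i)) := by
      intro m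
      rw [← Finset.sum_range_reflect (fun i => s i * v ^ (2 * (m - i))), ← Finset.sum_add_distrib]
      refine Finset.sum_congr rfl fun i hi => ?_
      rw [Finset.mem_range] at hi
      rw [show m + 1 - 1 - i = m - i by omega, show m - (m - i) = i by omega]; ring
    have key2 : ∀ m, ∑ i ∈ Finset.range (m + 2), s i * v ^ (2 * (m + 1 - i)) =
        v ^ 2 * ∑ i ∈ Finset.range (m + 1), s i * v ^ (2 * (m - i)) + s (m + 1) := by
      intro m
      rw [Finset.sum_range_succ, Finset.mul_sum]
      congr 1
      · refine Finset.sum_congr rfl fun i hi => ?_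
        rw [Finset.mem_range] at hi
        rw [show 2 * (m + 1 - i) = 2 + 2 * (m - i) by omega, pow_add]; ring
      · simp
    rw [shiftCoeff, shiftCoeff.eq_3, ih1, ih0, key, key, key, key2 (n + 1), key2 n,
      Finset.sum_range_succ _ (n + 2), Finset.sum_range_succ _ (n + 1)]
    ring

/-- The closed form of `shiftCoeff` for positive second index. The factor `v` on the left-hand side
avoids the exponent `j - 1`. The constant `S` only affects the degrees at the two ends. -/
theorem exists_mul_shiftCoeff {B : Type*} [CommRing B] (v : B) (s : ℕ → B) (m j : ℕ) :
    ∃ S ∈ Subring.closure (Set.range s), v * shiftCoeff v s (m + j + 1) (j + 1) =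
      -(v ^ (j + 2) * ∑ i ∈ Finset.range (m + 1), (s i + s (m - i)) * v ^ (2 * i)) -
        (1 + v ^ 2) * (v ^ j + v ^ (2 * m + 2 + j)) * S := by
  induction j with
  | zero =>
    refine ⟨0, Subring.zero_mem _, ?_⟩
    rw [shiftCoeff, add_zero, shiftCoeff_zero]; ring
  | succ j ih =>
    obtain ⟨S, hS, h⟩ := ih
    refine ⟨S + s (m + j + 1), Subring.add_mem _ hS (Subring.subset_closure ⟨_, rfl⟩), ?_⟩
    rw [← add_assoc, shiftCoeff, mul_sub, h,
      show 2 * (m + j + 1) - j = 2 * m + 2 + j by omega]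
    ring

variable {A : Type*} [CommRing A] (s : ℕ → A)

theorem coeff_shiftCoeff_of_lt {n k h : ℕ} (hk : h < k) (hn : 2 * k ≤ n) :
    (shiftCoeff (X : A[X]) (fun i => C (s i)) n (2 * h)).coeff (2 * k) =
      -(s (k - h) + s (n - k - h)) := by
  have sum_coeff : ∀ m, k - h ≤ m → (∑ i ∈ Finset.range (m + 1),
      (C (s i) + C (s (m - i))) * (X : A[X]) ^ (2 * i)).coeff (2 * (k - h)) =
        s (k - h) + s (m - (k - h)) := by
    intro m hm
    rw [finsetSum_coeff, Finset.sum_eq_single (k - h)]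
    · rw [← C_add, coeff_C_mul, coeff_X_pow, if_pos rfl, mul_one]
    · intro i _ hi
      rw [← C_add, coeff_C_mul, coeff_X_pow, if_neg (by omega), mul_zero]
    · intro h'; simp at h'; omega
  rcases h with _ | h
  · rw [shiftCoeff_zero, mul_add, mul_one]
    simp only [coeff_add, coeff_neg, coeff_C_mul, coeff_X_pow, coeff_C]
    have := sum_coeff n (by omega)
    rw [Nat.sub_zero] at this
    rw [this, if_neg (by omega), if_neg (by omega)]; simp
  · obtain ⟨m, rfl⟩ : ∃ m, n = m + (2 * h + 1) + 1 := ⟨n - (2 * h + 2), by omega⟩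
    obtain ⟨S, hS, e⟩ := exists_mul_shiftCoeff (X : A[X]) (fun i => C (s i)) m (2 * h + 1)
    have hS' : ∃ S' : A, S = C S' := by
      have : Subring.closure (Set.range fun i => C (s i)) ≤ (C : A →+* A[X]).range :=
        Subring.closure_le.2 (by rintro _ ⟨i, rfl⟩; exact ⟨_, rfl⟩)
      obtain ⟨S', h'⟩ := this hS
      exact ⟨S', h'.symm⟩
    obtain ⟨S, rfl⟩ := hS'
    have e' := congrArg (fun p => p.coeff (2 * k + 1)) e
    simp only [coeff_X_mul] at e'
    rw [show 2 * (h + 1) = 2 * h + 1 + 1 by ring, e', coeff_sub, coeff_neg, coeff_mul_C,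
      show 2 * k + 1 = 2 * (k - (h + 1)) + (2 * h + 1 + 2) by omega, coeff_X_pow_mul,
      sum_coeff _ (by omega)]
    simp only [one_add_mul, mul_add, ← pow_add, coeff_add, coeff_X_pow]
    rw [if_neg (by omega), if_neg (by omega), if_neg (by omega), if_neg (by omega),
      show m + (2 * h + 1) + 1 - k - (h + 1) = m - (k - (h + 1)) by omega]
    simp

theorem X_pow_dvd_shiftCoeff {n j : ℕ} (hj : j ≤ n) :
    (X : A[X]) ^ j ∣ shiftCoeff X (fun i => C (s i)) (n + 1) (j + 2) := by
  induction n generalizing j with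
  | zero => obtain rfl : j = 0 := by omega
            simp
  | succ n ih =>
    rw [shiftCoeff]
    refine dvd_sub ?_ (Dvd.dvd.mul_left (dvd_add dvd_rfl (pow_dvd_pow _ (by omega))) _)
    rcases j with _ | j
    · simp
    · rw [pow_succ']; exact mul_dvd_mul_left _ (ih (by omega))

theorem coeff_shiftCoeff_of_gt {n k h : ℕ} (hk : k + 1 < h) (hn : 2 * h ≤ n + 1) :
    (shiftCoeff (X : A[X]) (fun i => C (s i)) n (2 * h)).coeff (2 * k) = 0 := by
  obtain ⟨n, rfl⟩ : ∃ m, n = m + 1 := ⟨n - 1, by omega⟩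
  obtain ⟨j, hj⟩ : ∃ j, 2 * h = j + 2 := ⟨2 * h - 2, by omega⟩
  rw [hj]
  obtain ⟨p, hp⟩ := X_pow_dvd_shiftCoeff s (n := n) (j := j) (by omega)
  rw [hp, coeff_X_pow_mul', if_neg (by omega)]

/-- `shiftCoeff X s n j` has the parity of `j` as a polynomial. -/
theorem coeff_shiftCoeff_of_odd {n j c : ℕ} (hj : j ≤ n + 1) (hc : Odd (c + j)) :
    (shiftCoeff (X : A[X]) (fun i => C (s i)) n j).coeff c = 0 := by
  have hX : ∀ (p : A[X]) (c : ℕ), (∀ d, d + 1 = c → p.coeff d = 0) → (X * p).coeff c = 0 := by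
    intro p c h
    rcases c with _ | c
    · simp
    · rw [coeff_X_mul]; exact h _ rfl
  induction n generalizing j c with
  | zero => simp [shiftCoeff]
  | succ n ih =>
    rcases j with _ | _ | j
    · rw [shiftCoeff, one_add_mul, sq, mul_assoc, coeff_sub, coeff_sub, coeff_add, ih (by omega) hc,
        hX, hX,
        coeff_C_mul, ← sq, coeff_add, coeff_X_pow, coeff_X_pow, if_neg, if_neg]
      · simp
      · rintro rfl; revert hc; simp
      · rintro rfl; revert hc; decide
      · rintro d rfl; exact ih (by omega) (by rw [Nat.odd_iff] at *; omega)
      · rintro d rfl; refine hX _ _ ?_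
        rintro d rfl; refine ih (by omega) ?_
        rw [Nat.odd_iff] at *; omega
    · rw [shiftCoeff, coeff_sub, hX, mul_assoc, coeff_C_mul, mul_add, mul_one, ← pow_succ',
        coeff_add, coeff_X, coeff_X_pow, if_neg, if_neg]
      · simp
      · rw [Nat.odd_iff] at hc; omega
      · rw [Nat.odd_iff] at hc; omega
      · rintro d rfl; refine ih (by omega) ?_
        rw [Nat.odd_iff] at *; omega
    · rw [shiftCoeff, coeff_sub, hX, mul_assoc, coeff_C_mul, one_add_mul, mul_add, ← pow_add,
        ← pow_add]
      · simp only [coeff_add, coeff_X_pow]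
        rw [Nat.odd_iff] at hc
        rw [if_neg (by omega), if_neg (by omega), if_neg (by omega), if_neg (by omega)]
        simp
      · rintro d rfl; refine ih (by omega) ?_
        rw [Nat.odd_iff] at *; omega

end Coefficients

/-! ### Expansion of wedge products over weights -/

section Expansion

variable {B : Type*} [CommRing B]

theorem rho_zero (n : ℕ) : rho (n + 1) 0 = n := by simp [rho]

theorem rho_succ (n : ℕ) (i : Fin n) : rho (n + 1) i.succ = rho n i := by
  simp [rho]; ring

theorem rho_nonneg {n : ℕ} (i : Fin n) : 0 ≤ rho n i := by
  simp only [rho]; omega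

theorem rho_strictAnti (n : ℕ) : StrictAnti (rho n) := by
  intro i j h
  simp only [rho, Fin.lt_def] at *; omega

/-- The wedge product of the generators of indices `|(ν + ρ)_i|`. Up to identification of weights
which differ by a sign change, it represents the symbol `C_ν`. -/
noncomputable def weightWedge (B : Type*) [CommRing B] {n : ℕ} (ν : Weight n) :
    ExteriorAlgebra B (ℕ →₀ B) :=
  ιMulti B n fun i => Finsupp.single (ν i + rho n i).natAbs 1

theorem weightWedge_cons {n : ℕ} (a : ℤ) (ν : Weight n) :
    weightWedge B (Fin.cons a ν : Weight (n + 1)) = gen B (n + a) * weightWedge B ν := by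
  rw [weightWedge, ιMulti_succ_apply, gen, weightWedge]
  congr 3
  · simp [rho_zero, add_comm]
  · funext i; simp [Matrix.vecTail, rho_succ]

theorem weightWedge_nil (ν : Weight 0) : weightWedge B ν = 1 := by
  rw [weightWedge, ιMulti_zero_apply]

/-- The weight `e_1 + ⋯ + e_j`. -/
def colWt (n j : ℕ) : Weight n := fun i => if (i : ℕ) < j then 1 else 0

theorem colWt_zero (n : ℕ) : colWt n 0 = 0 := by funext i; simp [colWt]

theorem colWt_succ (n j : ℕ) : colWt (n + 1) (j + 1) = Fin.cons 1 (colWt n j) := by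
  funext i; refine Fin.cases ?_ (fun i => ?_) i <;> simp [colWt]

theorem wtTwo_succ (n h : ℕ) : wtTwo (n + 1) h = Fin.cons 2 (colWt n (2 * h)) := by
  funext i; refine Fin.cases ?_ (fun i => ?_) i <;> simp [colWt, wtTwo]

theorem wtOne_eq_colWt (n h : ℕ) : wtOne n h = colWt n (2 * h) := rfl

theorem weightWedge_zero (n : ℕ) : weightWedge B (0 : Weight n) = fullWedge B n := by
  induction n with
  | zero => rw [weightWedge_nil, fullWedge]
  | succ n ih =>
    rw [show (0 : Weight (n + 1)) = Fin.cons 0 (0 : Weight n) by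
      funext i; refine Fin.cases ?_ (fun i => ?_) i <;> simp, weightWedge_cons, ih, fullWedge,
      add_zero]

/-- The weight `e_1 + ⋯ + e_j` shifts the first `j` coordinates of `ρ` by `1`, which leaves the
gap `n - j`. -/
theorem weightWedge_colWt {n j : ℕ} (h : j ≤ n) : weightWedge B (colWt n j) = missWedge B n j := by
  induction n generalizing j with
  | zero => obtain rfl : j = 0 := by omega
            rw [weightWedge_nil, missWedge, fullWedge]
  | succ n ih =>
    rcases j with _ | j
    · rw [colWt_zero, weightWedge_zero, missWedge]
    · rw [colWt_succ, weightWedge_cons, ih (by omega), missWedge]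

/-- The number of coordinates equal to `1` or `-1`. -/
def ones {n : ℕ} (ν : Weight n) : ℕ := ∑ i, if (ν i).natAbs = 1 then 1 else 0

theorem ones_cons {n : ℕ} (a : ℤ) (ν : Weight n) :
    ones (Fin.cons a ν : Weight (n + 1)) = (if a.natAbs = 1 then 1 else 0) + ones ν := by
  rw [ones, ones, Fin.sum_univ_succ]; simp only [Fin.cons_zero, Fin.cons_succ]

/-- The weights with all coordinates in `{-1, 0, 1}`. -/
def smallWeights (n : ℕ) : Finset (Weight n) := Fintype.piFinset fun _ => {-1, 0, 1}

/-- A weight with coordinates in `{-1, 0, 1}` is either singular or conjugated to `e_1 + ⋯ + e_j`,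
by shifting the first `j` coordinates and by adjacent transpositions in the rest, each of which uses
up two coordinates `±1`. This determines the sign. -/
theorem weightWedge_small {n : ℕ} {ν : Weight n} (hν : ν ∈ smallWeights n) :
    weightWedge B ν = 0 ∨ ∃ j r, ones ν = j + 2 * r ∧ j ≤ n ∧
      weightWedge B ν = ((-1) ^ r : B) • missWedge B n j := by
  induction n with
  | zero => exact Or.inr ⟨0, 0, by simp [ones], le_rfl, by
      rw [weightWedge_nil, missWedge, fullWedge]; simp⟩
  | succ n ih =>
    obtain ⟨a, ν, rfl⟩ : ∃ a ν', ν = Fin.cons a ν' := ⟨ν 0, Fin.tail ν, (Fin.cons_self_tail ν).symm⟩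
    rw [smallWeights, Fintype.mem_piFinset] at hν
    have ha := hν 0
    have hν' : ν ∈ smallWeights n := by
      rw [smallWeights, Fintype.mem_piFinset]; intro i; simpa using hν i.succ
    rw [weightWedge_cons, ones_cons]
    rcases ih hν' with h | ⟨j, r, h1, h2, h3⟩
    · left; rw [h, mul_zero]
    · rw [h3, h1, mul_smul_comm]
      simp only [Fin.cons_zero, Finset.mem_insert, Finset.mem_singleton] at ha
      rcases ha with rfl | rfl | rfl
      · rcases n with _ | n
        · obtain rfl : j = 0 := by omega
          refine Or.inr ⟨1, r, by simp, by omega, ?_⟩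
          rw [← gen_neg]
          simp only [missWedge, fullWedge]; norm_num
        · rw [show ((n + 1 : ℕ) : ℤ) + -1 = n by push_cast; ring]
          rcases j with _ | _ | j
          · left; rw [gen_mul_missWedge_succ_zero, smul_zero]
          · refine Or.inr ⟨0, r + 1, by simp; ring, by omega, ?_⟩
            rw [gen_mul_missWedge_succ_one, pow_succ]; simp
          · left; rw [gen_mul_missWedge_succ_add_two, smul_zero]
      · rw [add_zero]
        rcases j with _ | j
        · exact Or.inr ⟨0, r, by simp, by omega, by rw [gen_mul_missWedge_zero]⟩
        · left; rw [gen_mul_missWedge_succ, smul_zero]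
      · exact Or.inr ⟨j + 1, r, by simp; ring, by omega, by rw [gen_add_one_mul_missWedge]⟩

/-- The admissible coordinates of a weight with `±2` at the place `p` and `0` or `±1` elsewhere. -/
def letters {n : ℕ} (p i : Fin n) : Finset ℤ := if i = p then {-2, 2} else {-1, 0, 1}

/-- The weights with `±2` at the place `p` and `0` or `±1` elsewhere. -/
def weightsAt {n : ℕ} (p : Fin n) : Finset (Weight n) := Fintype.piFinset (letters p)

/-- The weight given to a coordinate `a ∈ {-1, 0, 1}`: `1 + v ^ 2` for `0` and `v` for `±1`. -/
def smallCoeff (v : B) (a : ℤ) : B := if a = 0 then 1 + v ^ 2 else v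

/-- The weight given to the coordinate `a` at a place where `ρ` has the coordinate `m`. -/
def letterCoeff (v : B) (S : ℤ → B) (m a : ℤ) : B :=
  if a.natAbs = 2 then S (a.tdiv 2 * m) else smallCoeff v a

/-- The vector whose image in the exterior algebra is `mulGen v m`. -/
noncomputable def mulVec (v : B) (m : ℤ) : ℕ →₀ B :=
  ∑ a ∈ {-1, 0, 1}, smallCoeff v a • Finsupp.single (a + m).natAbs 1

theorem ι_mulVec (v : B) (m : ℤ) : ι B (mulVec v m) = mulGen v m := by
  simp only [mulVec, map_sum, map_smul, mulGen]
  rw [Finset.sum_insert (by decide), Finset.sum_insert (by decide), Finset.sum_singleton]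
  simp only [gen, smallCoeff]
  norm_num
  rw [show -1 + m = m - 1 by ring, add_comm 1 m]; abel

/-- The vector whose image in the exterior algebra is `shiftGen s m`. -/
noncomputable def shiftVec (S : ℤ → B) (m : ℤ) : ℕ →₀ B :=
  ∑ a ∈ {-2, 2}, S (a.tdiv 2 * m) • Finsupp.single (a + m).natAbs 1

theorem ι_shiftVec (S : ℤ → B) (hS : ∀ z, S (-z) = -S (z - 1)) (m : ℕ) :
    ι B (shiftVec S m) = shiftGen (fun i => S i) m := by
  have h : ι B (shiftVec S m) = S m • gen B (m + 2) + S (-m) • gen B (m - 2) := by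
    simp only [shiftVec, map_sum, map_smul]
    rw [Finset.sum_insert (by decide), Finset.sum_singleton]
    simp only [gen]
    rw [show (-2 : ℤ).tdiv 2 = -1 by decide, show (2 : ℤ).tdiv 2 = 1 by decide,
      show (-2 : ℤ) + m = m - 2 by ring, add_comm (2 : ℤ) m]
    simp [add_comm]
  rw [h]
  rcases m with _ | m
  · simp only [shiftGen]
    rw [show ((0 : ℕ) : ℤ) - 2 = -2 by norm_num, gen_neg]
    simp [two_mul, add_smul]
  · simp only [shiftGen]
    rw [hS]
    push_cast
    rw [show (m : ℤ) + 1 - 1 = m by ring, show (m : ℤ) + 1 + 2 = m + 3 by ring,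
      show (m : ℤ) + 1 - 2 = m - 1 by ring, neg_smul, ← sub_eq_add_neg]

theorem mulProd_eq_ιMulti (v : B) (n : ℕ) :
    mulProd v n = ιMulti B n fun i => mulVec v (rho n i) := by
  induction n with
  | zero => rw [mulProd, ιMulti_zero_apply]
  | succ n ih =>
    rw [mulProd, ih, ιMulti_succ_apply, rho_zero, ι_mulVec]
    congr 2
    funext i; simp [Matrix.vecTail, rho_succ]

theorem shiftSum_eq_ιMulti (v : B) (S : ℤ → B) (hS : ∀ z, S (-z) = -S (z - 1)) (n : ℕ) :
    shiftSum v (fun i => S i) n =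
      ∑ p, ιMulti B n fun i => if i = p then shiftVec S (rho n i) else mulVec v (rho n i) := by
  induction n with
  | zero => simp [shiftSum]
  | succ n ih =>
    rw [shiftSum, ih, Fin.sum_univ_succ, ιMulti_succ_apply, rho_zero, if_pos rfl,
      ι_shiftVec S hS, mulProd_eq_ιMulti, Finset.mul_sum]
    congr 1
    · congr 2
      funext i; simp [Matrix.vecTail, rho_succ]
    · refine Finset.sum_congr rfl fun p _ => ?_
      rw [ιMulti_succ_apply, rho_zero, if_neg (Fin.succ_ne_zero p).symm, ι_mulVec]
      congr 2
      funext i; simp [Matrix.vecTail, rho_succ]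

theorem ιMulti_sum_smul {n : ℕ} (A : Fin n → Finset ℤ) (c : Fin n → ℤ → B) :
    (ιMulti B n fun i => ∑ a ∈ A i, c i a • Finsupp.single (a + rho n i).natAbs (1 : B)) =
      ∑ ν ∈ Fintype.piFinset A, (∏ i, c i (ν i)) • weightWedge B ν := by
  refine ((ιMulti B n).toMultilinearMap.map_sum_finset (fun i a =>
    c i a • Finsupp.single (a + rho n i).natAbs (1 : B)) A).trans ?_
  refine Finset.sum_congr rfl fun ν _ => ?_
  exact (ιMulti B n).toMultilinearMap.map_smul_univ (fun i => c i (ν i)) _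

theorem mulProd_eq_sum (v : B) (n : ℕ) :
    mulProd v n = ∑ ν ∈ smallWeights n, (∏ i, smallCoeff v (ν i)) • weightWedge B ν := by
  rw [mulProd_eq_ιMulti]
  exact ιMulti_sum_smul _ _

theorem shiftSum_eq_sum (v : B) (S : ℤ → B) (hS : ∀ z, S (-z) = -S (z - 1)) (n : ℕ) :
    shiftSum v (fun i => S i) n = ∑ p, ∑ ν ∈ weightsAt p,
      (∏ i, letterCoeff v S (rho n i) (ν i)) • weightWedge B ν := by
  rw [shiftSum_eq_ιMulti v S hS]
  refine Finset.sum_congr rfl fun p _ => ?_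
  have : (fun i => if i = p then shiftVec S (rho n i) else mulVec v (rho n i)) = fun i =>
      ∑ a ∈ letters p i, letterCoeff v S (rho n i) a •
        Finsupp.single (a + rho n i).natAbs (1 : B) := by
    funext i
    by_cases h : i = p
    · rw [if_pos h, letters, if_pos h, shiftVec]
      refine Finset.sum_congr rfl fun a ha => ?_
      rw [letterCoeff, if_pos]
      simp at ha; omega
    · rw [if_neg h, letters, if_neg h, mulVec]
      refine Finset.sum_congr rfl fun a ha => ?_
      rw [letterCoeff, if_neg]
      simp at ha; omega
  rw [this]
  exact ιMulti_sum_smul _ _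

theorem prod_smallCoeff (v : B) {n : ℕ} {ν : Weight n} (hν : ν ∈ smallWeights n) :
    ∏ i, smallCoeff v (ν i) = v ^ ones ν * (1 + v ^ 2) ^ (n - ones ν) := by
  rw [smallWeights, Fintype.mem_piFinset] at hν
  have h : ∀ i, ν i ≠ 0 ↔ (ν i).natAbs = 1 := by
    intro i; have h' := hν i; simp only [Finset.mem_insert, Finset.mem_singleton] at h'; omega
  simp only [smallCoeff]
  rw [Finset.prod_ite, Finset.prod_const, Finset.prod_const, mul_comm]
  have h1 : (Finset.univ.filter fun i => ¬ν i = 0).card = ones ν := by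
    rw [ones, ← Finset.card_filter]; simp only [← h]
  have h2 := Finset.card_filter_add_card_filter_not (s := Finset.univ) (fun i => ν i = 0)
  rw [Finset.card_univ, Fintype.card_fin] at h2
  rw [← h1]; congr 2; omega

/-- Half of the coordinates `±2`: this is the weight `w ω` if `ν = w λ`. -/
def halfTwos {n : ℕ} (ν : Weight n) : Weight n := fun i => (ν i).tdiv 2

theorem prod_letterCoeff (v : B) (S : ℤ → B) {n : ℕ} {p : Fin n} {ν : Weight n}
    (hν : ν ∈ weightsAt p) :
    ∏ i, letterCoeff v S (rho n i) (ν i) =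
      S (rho n ⬝ᵥ halfTwos ν) * (v ^ ones ν * (1 + v ^ 2) ^ (n - 1 - ones ν)) := by
  rw [weightsAt, Fintype.mem_piFinset] at hν
  have hp : (ν p).natAbs = 2 := by have := hν p; simp [letters] at this; omega
  have hi : ∀ i ≠ p, ν i = -1 ∨ ν i = 0 ∨ ν i = 1 := by
    intro i h; have := hν i; simpa [letters, h] using this
  rw [← Finset.mul_prod_erase _ _ (Finset.mem_univ p)]
  congr 1
  · rw [letterCoeff, if_pos hp]
    congr 1
    rw [dotProduct, Finset.sum_eq_single p, mul_comm]; rfl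
    · intro i _ h
      rcases hi i h with h | h | h <;> simp [halfTwos, h]
    · simp
  · have : ∀ i ∈ Finset.univ.erase p, letterCoeff v S (rho n i) (ν i) =
        if ν i = 0 then 1 + v ^ 2 else v := by
      intro i h
      rw [letterCoeff, if_neg, smallCoeff]
      have := hi i (Finset.ne_of_mem_erase h); omega
    rw [Finset.prod_congr rfl this, Finset.prod_ite, Finset.prod_const, Finset.prod_const, mul_comm]
    have h1 : ((Finset.univ.erase p).filter fun i => ¬ν i = 0).card = ones ν := by
      rw [ones, ← Finset.card_filter]; congr 1; ext i
      simp only [Finset.mem_filter, Finset.mem_erase, Finset.mem_univ, and_true, true_and]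
      by_cases h : i = p
      · subst h; simp [hp]
      · have := hi i h; simp only [ne_eq, h, not_false_eq_true, true_and]; omega
    have h2 := Finset.card_filter_add_card_filter_not (s := Finset.univ.erase p) (fun i => ν i = 0)
    rw [Finset.card_erase_of_mem (Finset.mem_univ p), Finset.card_univ, Fintype.card_fin] at h2
    rw [← h1]; congr 2; omega

end Expansion

/-! ### Coefficients of symbols as determinants -/

section Coordinates

/-- The matrix with entry `1` at the places `(m, i)` with `a m = b i`, and `0` elsewhere. -/
def incidence {n : ℕ} (R : Type*) [CommRing R] (a b : Fin n → ℕ) : Matrix (Fin n) (Fin n) R :=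
  Matrix.of fun m i => if a m = b i then 1 else 0

theorem exists_perm_of_det_incidence_ne_zero {n : ℕ} {a b : Fin n → ℕ}
    (h : (incidence ℤ a b).det ≠ 0) : ∃ σ : Equiv.Perm (Fin n), ∀ i, a (σ i) = b i := by
  rw [Matrix.det_apply] at h
  obtain ⟨σ, -, hσ⟩ := Finset.exists_ne_zero_of_sum_ne_zero h
  refine ⟨σ, fun i => ?_⟩
  by_contra hi
  exact hσ (by rw [Finset.prod_eq_zero (Finset.mem_univ i)]; · simp
               · simp [incidence, hi])

theorem det_incidence_perm {n : ℕ} {a b c : Fin n → ℕ} (σ : Equiv.Perm (Fin n))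
    (h : ∀ i, a (σ i) = b i) :
    (incidence ℤ a c).det = (Equiv.Perm.sign σ : ℤ) * (incidence ℤ b c).det := by
  have : incidence ℤ b c = (incidence ℤ a c).submatrix σ id := by
    ext i j; simp [incidence, h]
  rw [this, Matrix.det_permute, ← mul_assoc]
  rcases Int.units_eq_one_or (Equiv.Perm.sign σ) with h | h <;> simp [h]

theorem det_incidence_strictAnti {n : ℕ} {a b : Fin n → ℕ} (ha : StrictAnti a)
    (hb : StrictAnti b) : (incidence ℤ a b).det = if a = b then 1 else 0 := by
  split_ifs with h
  · subst h
    have : incidence ℤ a a = 1 := by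
      ext i j; simp [incidence, Matrix.one_apply, ha.injective.eq_iff]
    rw [this, Matrix.det_one]
  · by_contra h0
    obtain ⟨σ, hσ⟩ := exists_perm_of_det_incidence_ne_zero h0
    refine h ?_
    have h1 : StrictMono (OrderDual.toDual ∘ a) := fun i j hij => ha hij
    have h2 : StrictMono (OrderDual.toDual ∘ b) := fun i j hij => hb hij
    have h3 : Set.range (OrderDual.toDual ∘ a) = Set.range (OrderDual.toDual ∘ b) := by
      have : OrderDual.toDual ∘ b = (OrderDual.toDual ∘ a) ∘ σ := by
        funext i; simp [hσ]
      rw [this, Set.range_comp _ σ, σ.surjective.range_eq, Set.image_univ]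
    exact (StrictMono.range_inj h1 h2).1 h3

/-- The absolute values of the coordinates of `μ + ρ`. -/
def absRho {n : ℕ} (μ : Weight n) (i : Fin n) : ℕ := (μ i + rho n i).natAbs

/-- The coefficient of the symbol `C_μ` in `C_ν`, for a dominant weight `μ` with nonnegative
coordinates and up to sign changes: the sign of the permutation which takes the absolute values of
the coordinates of `ν + ρ` to those of `μ + ρ`, and `0` if there is none. -/
def kappa {n : ℕ} (ν μ : Weight n) : ℤ := (incidence ℤ (absRho ν) (absRho μ)).det

/-- Dominant weights with nonnegative coordinates. They represent the orbits of the dominant weights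
under the change of sign of the last coordinate. -/
def NonnegDominant {n : ℕ} (μ : Weight n) : Prop := Antitone μ ∧ ∀ i, 0 ≤ μ i

theorem NonnegDominant.strictAnti {n : ℕ} {μ : Weight n} (h : NonnegDominant μ) :
    StrictAnti (absRho μ) := by
  intro i j hij
  have h1 := h.1 hij.le
  have h2 := h.2 i
  have h3 := h.2 j
  have h4 := rho_strictAnti n hij
  have h5 := rho_nonneg j
  simp only [absRho]; omega

theorem absRho_injective_of_nonneg {n : ℕ} {μ ν : Weight n} (hμ : ∀ i, 0 ≤ μ i)
    (hν : ∀ i, 0 ≤ ν i) (h : absRho μ = absRho ν) : μ = ν := by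
  funext i
  have := congrFun h i
  have h1 := hμ i
  have h2 := hν i
  have h3 := rho_nonneg i
  simp only [absRho] at this; omega

theorem kappa_of_nonnegDominant {n : ℕ} {ν μ : Weight n} (hν : NonnegDominant ν)
    (hμ : NonnegDominant μ) : kappa ν μ = if ν = μ then 1 else 0 := by
  rw [kappa, det_incidence_strictAnti hν.strictAnti hμ.strictAnti]
  refine if_congr ⟨absRho_injective_of_nonneg hν.2 hμ.2, fun h => h ▸ rfl⟩ rfl rfl

variable (B : Type*) [CommRing B]

/-- The linear functional on the exterior algebra which gives the coefficient of `C_μ`. -/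
noncomputable def coordFunctional {n : ℕ} (μ : Weight n) : ExteriorAlgebra B (ℕ →₀ B) →ₗ[B] B :=
  liftAlternating (Pi.single n (Matrix.detRowAlternating.compLinearMap
    (LinearMap.pi fun i => Finsupp.lapply (absRho μ i))))

theorem coordFunctional_weightWedge {n : ℕ} (ν μ : Weight n) :
    coordFunctional B μ (weightWedge B ν) = (kappa ν μ : B) := by
  rw [coordFunctional, weightWedge, liftAlternating_apply_ιMulti, Pi.single_eq_same, kappa,
    ← eq_intCast (Int.castRingHom B), RingHom.map_det]
  change Matrix.det _ = _
  congr 1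
  ext m i
  simp only [incidence, absRho, Finsupp.single_apply, LinearMap.pi_apply, Finsupp.lapply_apply,
    Matrix.of_apply, RingHom.mapMatrix_apply, Matrix.map_apply]
  by_cases h : (ν m + rho n m).natAbs = (μ i + rho n i).natAbs <;> simp [h]

theorem nonnegDominant_colWt (n j : ℕ) : NonnegDominant (colWt n j) := by
  refine ⟨fun a b h => ?_, fun i => ?_⟩
  · rw [Fin.le_def] at h
    simp only [colWt]; split_ifs <;> omega
  · simp only [colWt]; split_ifs <;> omega

theorem nonnegDominant_cons_two (n j : ℕ) :
    NonnegDominant (Fin.cons 2 (colWt n j) : Weight (n + 1)) := by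
  refine ⟨fun a b h => ?_, fun i => ?_⟩
  · induction a using Fin.cases with
    | zero =>
      induction b using Fin.cases with
      | zero => rfl
      | succ b => simp only [Fin.cons_zero, Fin.cons_succ, colWt]; split_ifs <;> omega
    | succ a =>
      induction b using Fin.cases with
      | zero => exact absurd h (by simp)
      | succ b =>
        simp only [Fin.cons_succ]
        exact (nonnegDominant_colWt n j).1 (Fin.succ_le_succ_iff.1 h)
  · induction i using Fin.cases with
    | zero => simp
    | succ i => simp only [Fin.cons_succ]; exact (nonnegDominant_colWt n j).2 i

variable {B}

theorem coordFunctional_missWedge {n j : ℕ} (hj : j ≤ n) {μ : Weight n} (hμ : NonnegDominant μ) :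
    coordFunctional B μ (missWedge B n j) = if colWt n j = μ then 1 else 0 := by
  rw [← weightWedge_colWt hj, coordFunctional_weightWedge,
    kappa_of_nonnegDominant (nonnegDominant_colWt n j) hμ]
  split_ifs <;> simp

theorem coordFunctional_gen_mul_missWedge {n j : ℕ} (hj : j ≤ n) {μ : Weight (n + 1)}
    (hμ : NonnegDominant μ) : coordFunctional B μ (gen B (n + 2) * missWedge B n j) =
      if (Fin.cons 2 (colWt n j) : Weight (n + 1)) = μ then 1 else 0 := by
  rw [← weightWedge_colWt hj, ← weightWedge_cons, coordFunctional_weightWedge,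
    kappa_of_nonnegDominant (nonnegDominant_cons_two n j) hμ]
  split_ifs <;> simp

theorem coordFunctional_extSum {n : ℕ} (v : B) {μ : Weight n} (hμ : NonnegDominant μ) :
    coordFunctional B μ (extSum v n) = ∑ j ∈ Finset.range (n + 1),
      if colWt n j = μ then v ^ j + v ^ (2 * n - j) else 0 := by
  rw [extSum, map_sum]
  refine Finset.sum_congr rfl fun j hj => ?_
  rw [map_smul, coordFunctional_missWedge (by simpa [Nat.lt_succ_iff] using hj) hμ]
  simp

theorem coordFunctional_shiftSum {n : ℕ} (v : B) (s : ℕ → B) {μ : Weight (n + 1)}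
    (hμ : NonnegDominant μ) :
    coordFunctional B μ (shiftSum v s (n + 1)) =
      (∑ j ∈ Finset.range (n + 2), if colWt (n + 1) j = μ then shiftCoeff v s n j else 0) +
        s n * ∑ j ∈ Finset.range (n + 1), if (Fin.cons 2 (colWt n j) : Weight (n + 1)) = μ then
          v ^ j + v ^ (2 * n - j) else 0 := by
  rw [shiftSum_succ, map_add, map_smul, extSum, Finset.mul_sum, map_sum, map_sum, smul_eq_mul]
  congr 1
  · refine Finset.sum_congr rfl fun j hj => ?_
    rw [map_smul, coordFunctional_missWedge (by rw [Finset.mem_range] at hj; omega) hμ]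
    simp
  · congr 1
    refine Finset.sum_congr rfl fun j hj => ?_
    rw [mul_smul_comm, map_smul,
      coordFunctional_gen_mul_missWedge (by rw [Finset.mem_range] at hj; omega) hμ]
    simp

theorem colWt_injOn {n i j : ℕ} (hi : i ≤ n) (hj : j ≤ n) (h : colWt n i = colWt n j) : i = j := by
  wlog hij : i < j generalizing i j
  · rcases Nat.lt_trichotomy i j with h' | h' | h'
    · exact absurd h' hij
    · exact h'
    · exact (this hj hi h.symm h').symm
  · have := congrFun h ⟨i, by omega⟩
    simp [colWt, hij] at this

end Coordinates

/-! ### Weyl group orbits -/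

section Weyl

theorem natAbs_act {n : ℕ} (w : SignedPerm n) (x : Weight n) (i : Fin n) :
    (act w x i).natAbs = (x (w.1.symm i)).natAbs := by
  simp [act, Int.natAbs_mul]

theorem sum_natAbs_act {n : ℕ} {M : Type*} [AddCommMonoid M] (g : ℕ → M) (w : SignedPerm n)
    (x : Weight n) : ∑ i, g (act w x i).natAbs = ∑ i, g (x i).natAbs := by
  simp only [natAbs_act]
  exact Equiv.sum_comp w.1.symm fun i => g (x i).natAbs

theorem act_add {n : ℕ} (w : SignedPerm n) (x y : Weight n) :
    act w (x + y) = act w x + act w y := by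
  funext i; simp [act, mul_add]

theorem prod_act {n : ℕ} {w : SignedPerm n} (hw : w ∈ weylGroup n) (x : Weight n) :
    ∏ i, act w x i = ∏ i, x i := by
  have hw' : ∏ i, w.2 i = 1 := (Finset.mem_filter.1 hw).2
  simp only [act]
  rw [Finset.prod_mul_distrib, ← Units.coe_prod, hw', Units.val_one, one_mul]
  exact Equiv.prod_comp w.1.symm x

/-- Two vectors with the same absolute values up to the order of the coordinates, and with the same
product of coordinates, are conjugated under the Weyl group. -/
theorem exists_mem_weylGroup {n : ℕ} {x y : Weight n} (σ : Equiv.Perm (Fin n))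
    (h : ∀ i, (y i).natAbs = (x (σ.symm i)).natAbs) (hp : ∏ i, y i = ∏ i, x i) :
    ∃ w ∈ weylGroup n, w.1 = σ ∧ act w x = y := by
  let ε : Fin n → ℤˣ := fun i => if y i = x (σ.symm i) then 1 else -1
  have hε : ∀ i, (ε i : ℤ) * x (σ.symm i) = y i := by
    intro i
    have := h i
    simp only [ε]
    split_ifs with h'
    · simp [h']
    · simp only [Units.val_neg, Units.val_one]; omega
  by_cases hz : ∃ i, y i = 0
  · obtain ⟨i, hi⟩ := hz
    have hxi : x (σ.symm i) = 0 := by have := h i; rw [hi] at this; omega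
    -- The sign at a coordinate `0` is free; it is used to make the number of sign changes even.
    rcases Int.units_eq_one_or (∏ i, ε i) with h1 | h1
    · exact ⟨(σ, ε), Finset.mem_filter.2 ⟨Finset.mem_univ _, h1⟩, rfl, funext hε⟩
    · refine ⟨(σ, Function.update ε i (-ε i)), Finset.mem_filter.2 ⟨Finset.mem_univ _, ?_⟩, rfl, ?_⟩
      · rw [Finset.prod_update_of_mem (Finset.mem_univ i), neg_mul,
          ← Finset.erase_eq, Finset.mul_prod_erase _ _ (Finset.mem_univ i), h1, neg_neg]
      · funext j
        by_cases hj : j = i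
        · subst hj; simp [act, hxi, hi]
        · simp [act, hj, hε]
  · refine ⟨(σ, ε), Finset.mem_filter.2 ⟨Finset.mem_univ _, ?_⟩, rfl, funext hε⟩
    have h0 : ∏ i, y i ≠ 0 := Finset.prod_ne_zero_iff.2 fun i _ hi => hz ⟨i, hi⟩
    have h1 : ∏ i, y i = ((∏ i, ε i : ℤˣ) : ℤ) * ∏ i, x i := by
      rw [Units.coe_prod, ← Equiv.prod_comp σ.symm x, ← Finset.prod_mul_distrib]
      exact Finset.prod_congr rfl fun i _ => (hε i).symm
    rw [← hp] at h1
    rcases Int.units_eq_one_or (∏ i, ε i) with h2 | h2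
    · exact h2
    · rw [h2] at h1; simp only [Units.val_neg, Units.val_one] at h1; omega

/-- The orbit of a weight under all signed permutations. -/
def fullOrbit {n : ℕ} (lam : Weight n) : Finset (Weight n) :=
  Finset.univ.image fun w : SignedPerm n => act w lam

theorem mem_fullOrbit {n : ℕ} {lam ν : Weight n} : ν ∈ fullOrbit lam ↔
    ∃ σ : Equiv.Perm (Fin n), ∀ i, (ν i).natAbs = (lam (σ i)).natAbs := by
  constructor
  · intro h
    obtain ⟨w, -, rfl⟩ := Finset.mem_image.1 h
    exact ⟨w.1.symm, natAbs_act w lam⟩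
  · rintro ⟨σ, h⟩
    refine Finset.mem_image.2 ⟨(σ.symm, fun i => if ν i = lam (σ i) then 1 else -1),
      Finset.mem_univ _, funext fun i => ?_⟩
    have := h i
    simp only [act, Equiv.symm_symm]
    split_ifs with h'
    · simp [h']
    · simp only [Units.val_neg, Units.val_one]; omega

/-- The Weyl group orbits in an orbit under all signed permutations are told apart by the product of
the coordinates. -/
theorem mem_orbit {n : ℕ} {lam ν : Weight n} :
    ν ∈ orbit lam ↔ ν ∈ fullOrbit lam ∧ ∏ i, ν i = ∏ i, lam i := by
  constructor
  · intro h
    obtain ⟨w, hw, rfl⟩ := Finset.mem_image.1 h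
    exact ⟨Finset.mem_image.2 ⟨w, Finset.mem_univ _, rfl⟩, prod_act hw lam⟩
  · rintro ⟨h, hp⟩
    obtain ⟨σ, hσ⟩ := mem_fullOrbit.1 h
    obtain ⟨w, hw, -, e⟩ := exists_mem_weylGroup σ.symm (by simpa using hσ) hp
    exact Finset.mem_image.2 ⟨w, hw, e⟩

/-- The weight with the sign of the last coordinate changed. -/
def flipLast {n : ℕ} (ν : Weight (n + 1)) : Weight (n + 1) :=
  Function.update ν (Fin.last n) (-ν (Fin.last n))

theorem flipLast_flipLast {n : ℕ} (ν : Weight (n + 1)) : flipLast (flipLast ν) = ν := by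
  simp [flipLast]

theorem natAbs_flipLast {n : ℕ} (ν : Weight (n + 1)) (i : Fin (n + 1)) :
    (flipLast ν i).natAbs = (ν i).natAbs := by
  by_cases h : i = Fin.last n
  · subst h; simp [flipLast]
  · simp [flipLast, h]

theorem prod_flipLast {n : ℕ} (ν : Weight (n + 1)) : ∏ i, flipLast ν i = -∏ i, ν i := by
  rw [Fin.prod_univ_castSucc, Fin.prod_univ_castSucc]
  simp [flipLast, Fin.castSucc_ne_last]

theorem rho_last (n : ℕ) : rho (n + 1) (Fin.last n) = 0 := by simp [rho]

theorem flipLast_add_rho {n : ℕ} (ν : Weight (n + 1)) :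
    flipLast ν + rho (n + 1) = flipLast (ν + rho (n + 1)) := by
  funext i
  by_cases h : i = Fin.last n
  · subst h; simp [flipLast, rho_last]
  · simp [flipLast, h]

theorem absRho_flipLast {n : ℕ} (ν : Weight (n + 1)) : absRho (flipLast ν) = absRho ν := by
  funext i
  have := natAbs_flipLast (ν + rho (n + 1)) i
  rw [← flipLast_add_rho] at this
  exact this

theorem kappa_flipLast {n : ℕ} (ν μ : Weight (n + 1)) : kappa (flipLast ν) μ = kappa ν μ := by
  rw [kappa, absRho_flipLast, kappa]

theorem flipLast_mem_fullOrbit {n : ℕ} {lam ν : Weight (n + 1)} (h : ν ∈ fullOrbit lam) :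
    flipLast ν ∈ fullOrbit lam := by
  obtain ⟨σ, hσ⟩ := mem_fullOrbit.1 h
  exact mem_fullOrbit.2 ⟨σ, fun i => by rw [natAbs_flipLast, hσ]⟩

theorem natAbs_prod_of_mem_fullOrbit {n : ℕ} {lam ν : Weight n} (h : ν ∈ fullOrbit lam) :
    (∏ i, ν i).natAbs = (∏ i, lam i).natAbs := by
  obtain ⟨σ, hσ⟩ := mem_fullOrbit.1 h
  have e : ∀ x : Weight n, (∏ i, x i).natAbs = ∏ i, (x i).natAbs := fun x =>
    map_prod Int.natAbsHom x Finset.univ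
  rw [e, e, ← Equiv.prod_comp σ fun i => (lam i).natAbs]
  exact Finset.prod_congr rfl fun i _ => hσ i

/-- If `lam` has no coordinate `0`, its orbit under all signed permutations consists of two Weyl
group orbits, exchanged by the sign change of the last coordinate. -/
theorem sum_fullOrbit {n : ℕ} {M : Type*} [AddCommMonoid M] (lam : Weight (n + 1))
    (G : Weight (n + 1) → M) (hG : ∀ ν, G (flipLast ν) = G ν) :
    ∑ ν ∈ fullOrbit lam, G ν = (if ∃ i, lam i = 0 then 1 else 2) • ∑ ν ∈ orbit lam, G ν := by
  have ho : orbit lam = (fullOrbit lam).filter fun ν => ∏ i, ν i = ∏ i, lam i := by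
    ext ν; rw [mem_orbit, Finset.mem_filter]
  split_ifs with h
  · obtain ⟨i, hi⟩ := h
    have h0 : ∏ i, lam i = 0 := Finset.prod_eq_zero (Finset.mem_univ i) hi
    rw [one_smul, ho, Finset.filter_true_of_mem]
    intro ν hν
    have := natAbs_prod_of_mem_fullOrbit hν
    omega
  · have h0 : ∏ i, lam i ≠ 0 := Finset.prod_ne_zero_iff.2 fun i _ hi => h ⟨i, hi⟩
    rw [two_smul, ho, ← Finset.sum_filter_add_sum_filter_not (fullOrbit lam)
      (fun ν => ∏ i, ν i = ∏ i, lam i)]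
    congr 1
    refine Finset.sum_nbij' flipLast flipLast ?_ ?_ (fun ν _ => flipLast_flipLast ν)
      (fun ν _ => flipLast_flipLast ν) (fun ν _ => (hG ν).symm)
    · intro ν hν
      rw [Finset.mem_filter] at *
      refine ⟨flipLast_mem_fullOrbit hν.1, ?_⟩
      have := natAbs_prod_of_mem_fullOrbit hν.1
      rw [prod_flipLast]; omega
    · intro ν hν
      rw [Finset.mem_filter] at *
      refine ⟨flipLast_mem_fullOrbit hν.1, ?_⟩
      rw [prod_flipLast]; omega

theorem NonnegDominant.dominant {n : ℕ} {μ : Weight n} (h : NonnegDominant μ) : Dominant μ :=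
  fun i j hij => ⟨by have := h.1 hij.le; omega, by have := h.2 i; have := h.2 j; omega⟩

theorem NonnegDominant.dominant_flipLast {n : ℕ} {μ : Weight (n + 1)} (h : NonnegDominant μ) :
    Dominant (flipLast μ) := by
  intro i j hij
  have h1 := h.1 hij.le
  have h2 := h.2 i
  have h3 := h.2 j
  have h4 := natAbs_flipLast μ j
  have h5 : flipLast μ i = μ i := by
    rw [flipLast, Function.update_of_ne (hij.trans_le (Fin.le_last j)).ne]
  omega

/-- If `C_μ` occurs in `C_ν` up to signs, then `ν` is conjugated to `μ` or to `μ` with the sign of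
the last coordinate changed. Both are dominant. -/
theorem exists_dominant_of_kappa_ne_zero {n : ℕ} {ν μ : Weight (n + 1)} (hμ : NonnegDominant μ)
    (h : kappa ν μ ≠ 0) : ∃ p : SignedPerm (n + 1) × Weight (n + 1),
      p.1 ∈ weylGroup (n + 1) ∧ Dominant p.2 ∧ act p.1 (ν + rho (n + 1)) = p.2 + rho (n + 1) := by
  obtain ⟨σ, hσ⟩ := exists_perm_of_det_incidence_ne_zero h
  have hfull : μ + rho (n + 1) ∈ fullOrbit (ν + rho (n + 1)) :=
    mem_fullOrbit.2 ⟨σ, fun i => (hσ i).symm⟩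
  have hfull' : ∀ i, ((flipLast μ + rho (n + 1)) i).natAbs = ((ν + rho (n + 1)) (σ i)).natAbs := by
    intro i; rw [flipLast_add_rho, natAbs_flipLast]; exact (hσ i).symm
  by_cases hp : ∏ i, (μ + rho (n + 1)) i = ∏ i, (ν + rho (n + 1)) i
  · obtain ⟨w, hw, -, e⟩ := exists_mem_weylGroup σ.symm
      (y := μ + rho (n + 1)) (x := ν + rho (n + 1)) (fun i => (hσ i).symm) hp
    exact ⟨(w, μ), hw, hμ.dominant, e⟩
  · have hp' : ∏ i, (flipLast μ + rho (n + 1)) i = ∏ i, (ν + rho (n + 1)) i := by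
      have := natAbs_prod_of_mem_fullOrbit hfull
      rw [flipLast_add_rho, prod_flipLast]; omega
    obtain ⟨w, hw, -, e⟩ := exists_mem_weylGroup σ.symm hfull' hp'
    exact ⟨(w, flipLast μ), hw, hμ.dominant_flipLast, e⟩

theorem Dominant.natAbs_le {n : ℕ} {μ : Weight n} (h : Dominant μ) {i j : Fin n} (hij : i < j) :
    ((μ j).natAbs : ℤ) ≤ μ i := by
  have := h i j hij; omega

/-- Among the conjugates of `ρ`, the largest pairing with a dominant weight is attained at `ρ`. This
is the rearrangement inequality, applied to the absolute values of the coordinates. -/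
theorem dominant_dotProduct_act_rho_le {n : ℕ} {μ : Weight (n + 1)} (h : Dominant μ)
    (w : SignedPerm (n + 1)) : μ ⬝ᵥ act w (rho (n + 1)) ≤ μ ⬝ᵥ rho (n + 1) := by
  have h1 : ∀ i, μ i * rho (n + 1) i = ((μ i).natAbs : ℤ) * rho (n + 1) i := by
    intro i
    rcases (Fin.le_last i).lt_or_eq with hi | rfl
    · have := h.natAbs_le hi
      rw [Int.natAbs_of_nonneg (by omega)]
    · rw [rho_last]; simp
  have hmono : Monovary (fun i => ((μ i).natAbs : ℤ)) (rho (n + 1)) := by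
    intro i j hij
    have hji : j < i := (rho_strictAnti (n + 1)).lt_iff_gt.1 hij
    have := h.natAbs_le hji
    show ((μ i).natAbs : ℤ) ≤ ((μ j).natAbs : ℤ)
    omega
  calc μ ⬝ᵥ act w (rho (n + 1))
      ≤ ∑ i, ((μ i).natAbs : ℤ) * rho (n + 1) (w.1.symm i) := by
        refine Finset.sum_le_sum fun i _ => ?_
        have h2 : (act w (rho (n + 1)) i).natAbs = (rho (n + 1) (w.1.symm i)).natAbs :=
          natAbs_act w _ i
        have h3 := rho_nonneg (w.1.symm i)
        rw [← Int.natAbs_of_nonneg h3, ← h2, Int.natCast_natAbs, Int.natCast_natAbs, ← abs_mul]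
        exact le_abs_self _
    _ ≤ ∑ i, ((μ i).natAbs : ℤ) * rho (n + 1) i := hmono.sum_mul_comp_perm_le_sum_mul
    _ = μ ⬝ᵥ rho (n + 1) := Finset.sum_congr rfl fun i _ => (h1 i).symm

end Weyl

/-! ### Reduction of symbols -/

section Reduced

theorem ones_colWt {n j : ℕ} (h : j ≤ n) : ones (colWt n j) = j := by
  induction n generalizing j with
  | zero => obtain rfl : j = 0 := by omega
            simp [ones]
  | succ n ih =>
    rcases j with _ | j
    · simp [colWt_zero, ones]
    · rw [colWt_succ, ones_cons, ih (by omega)]; simp [add_comm]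

theorem dotProduct_self_eq {n : ℕ} (x : Weight n) : x ⬝ᵥ x = ∑ i, ((x i).natAbs : ℤ) ^ 2 := by
  simp only [dotProduct, Int.natCast_natAbs, sq_abs, ← sq]

theorem dotProduct_self_act {n : ℕ} (w : SignedPerm n) (x : Weight n) :
    act w x ⬝ᵥ act w x = x ⬝ᵥ x := by
  rw [dotProduct_self_eq, dotProduct_self_eq]
  exact sum_natAbs_act (fun a => (a : ℤ) ^ 2) w x

theorem dotProduct_self_wtTwo {n k : ℕ} (hk : 2 * k ≤ n) :
    wtTwo (n + 1) k ⬝ᵥ wtTwo (n + 1) k = 2 * k + 4 := by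
  have h : colWt n (2 * k) ⬝ᵥ colWt n (2 * k) = ((ones (colWt n (2 * k)) : ℕ) : ℤ) := by
    rw [dotProduct, ones]; push_cast
    refine Finset.sum_congr rfl fun i _ => ?_
    simp only [colWt]; split_ifs <;> simp_all
  rw [ones_colWt hk] at h
  rw [wtTwo_succ, dotProduct, Fin.sum_univ_succ]
  simp only [Fin.cons_zero, Fin.cons_succ]
  rw [dotProduct] at h
  rw [h]; push_cast; ring

/-- If `λ` is dominant and `λ + ρ` is conjugated to `ν + ρ`, then `λ` is not longer than `ν`; if it
has the same length, then it is conjugated to `ν`. -/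
theorem dotProduct_self_le_of_conj {n : ℕ} {ν lam : Weight (n + 1)} (hl : Dominant lam)
    {w : SignedPerm (n + 1)} (h : act w (ν + rho (n + 1)) = lam + rho (n + 1)) :
    lam ⬝ᵥ lam ≤ ν ⬝ᵥ ν ∧ (lam ⬝ᵥ lam = ν ⬝ᵥ ν → act w ν = lam) := by
  have hle := dominant_dotProduct_act_rho_le hl w
  set δ : Weight (n + 1) := rho (n + 1) - act w (rho (n + 1)) with hδ
  have h1 : act w ν = lam + δ := by
    rw [act_add] at h
    rw [hδ, ← add_sub_assoc, ← h]; simp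
  have h2 : ν ⬝ᵥ ν = lam ⬝ᵥ lam + 2 * (lam ⬝ᵥ δ) + δ ⬝ᵥ δ := by
    rw [← dotProduct_self_act w, h1, dotProduct_add, add_dotProduct, add_dotProduct,
      dotProduct_comm δ lam]
    ring
  have h3 : 0 ≤ lam ⬝ᵥ δ := by rw [hδ, dotProduct_sub]; omega
  have h4 : 0 ≤ δ ⬝ᵥ δ := Finset.sum_nonneg fun i _ => mul_self_nonneg _
  refine ⟨by omega, fun he => ?_⟩
  have h5 : δ ⬝ᵥ δ = 0 := by omega
  rw [h1, dotProduct_self_eq_zero.1 h5, add_zero]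

/-- The symbols of dominant weights with a negative last coordinate do not occur, except for
`C_{2ω_{n-1}}` for `n` even. -/
theorem nonnegDominant_or_eq_twoOmegaPred {n k : ℕ} (hk : 2 * k ≤ n) {ν lam : Weight (n + 1)}
    (hν : ν ∈ orbit (wtTwo (n + 1) k)) (hl : Dominant lam) {w : SignedPerm (n + 1)}
    (hw : w ∈ weylGroup (n + 1)) (h : act w (ν + rho (n + 1)) = lam + rho (n + 1)) :
    NonnegDominant lam ∨ Even (n + 1) ∧ lam = twoOmegaPred (n + 1) := by
  have hνν : ν ⬝ᵥ ν = 2 * k + 4 := by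
    obtain ⟨w', -, rfl⟩ := Finset.mem_image.1 hν
    rw [dotProduct_self_act, dotProduct_self_wtTwo hk]
  by_cases hneg : ∀ i, 0 ≤ lam i
  · refine Or.inl ⟨fun i j hij => ?_, hneg⟩
    rcases hij.lt_or_eq with h' | rfl
    · have := hl i j h'; omega
    · rfl
  right
  obtain ⟨i, hi⟩ := not_forall.1 hneg
  have hlast : lam (Fin.last n) < 0 := by
    rcases (Fin.le_last i).lt_or_eq with h' | rfl
    · have := hl.natAbs_le h'; omega
    · omega
  have hpos : ∀ i ≠ Fin.last n, 0 < lam i := by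
    intro i hi
    have := hl.natAbs_le (Fin.lt_last_iff_ne_last.2 hi); omega
  obtain ⟨hle, heq⟩ := dotProduct_self_le_of_conj hl h
  have hsq : ∀ i, 1 ≤ lam i * lam i := by
    intro i
    by_cases hi : i = Fin.last n
    · subst hi; nlinarith
    · nlinarith [hpos i hi]
  have hsmall : ∀ i, lam i * lam i < 4 := by
    intro i
    by_contra! h4
    have hsum : (n : ℤ) + 4 ≤ lam ⬝ᵥ lam := by
      rw [dotProduct, ← Finset.add_sum_erase _ _ (Finset.mem_univ i)]
      have := Finset.card_nsmul_le_sum (Finset.univ.erase i) (fun j => lam j * lam j) 1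
        fun j _ => hsq j
      rw [Finset.card_erase_of_mem (Finset.mem_univ i), Finset.card_univ, Fintype.card_fin,
        Nat.add_sub_cancel, nsmul_one] at this
      omega
    -- `λ` has the length of `ν`, hence lies in the orbit, but has the wrong product of coordinates.
    have hconj := heq (by omega)
    have hp : ∏ i, lam i = ∏ i, wtTwo (n + 1) k i := by
      rw [← hconj, prod_act hw, (mem_orbit.1 hν).2]
    have h1 : 0 ≤ ∏ i, wtTwo (n + 1) k i := Finset.prod_nonneg fun i _ => by
      simp only [wtTwo]; split_ifs <;> omega
    have h2 : ∏ i, lam i < 0 := by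
      rw [Fin.prod_univ_castSucc]
      exact mul_neg_of_pos_of_neg
        (Finset.prod_pos fun i _ => hpos _ (Fin.castSucc_ne_last i)) hlast
    omega
  have hval : lam = twoOmegaPred (n + 1) := by
    funext i
    have h1 := hsmall i
    by_cases hi : i = Fin.last n
    · subst hi
      simp only [twoOmegaPred, Fin.val_last, if_true]; nlinarith
    · have h2 := hpos i hi
      have h3 : (i : ℕ) + 1 ≠ n + 1 := fun h' => hi (Fin.ext (by simpa using h'))
      simp only [twoOmegaPred, if_neg h3]; nlinarith
  refine ⟨?_, hval⟩
  have hll : lam ⬝ᵥ lam = n + 1 := by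
    rw [dotProduct, Finset.sum_congr rfl (g := fun _ => (1 : ℤ))]
    · simp
    · intro i _
      rw [hval]; simp only [twoOmegaPred]; split_ifs <;> norm_num
  have h1 : (ν + rho (n + 1)) ⬝ᵥ (ν + rho (n + 1)) =
      (lam + rho (n + 1)) ⬝ᵥ (lam + rho (n + 1)) := by
    rw [← h, dotProduct_self_act]
  simp only [dotProduct_add, add_dotProduct] at h1
  rw [dotProduct_comm (rho (n + 1)) ν, dotProduct_comm (rho (n + 1)) lam] at h1
  -- The squared lengths `n + 1` of `λ` and `2k + 4` of `ν` have the same parity.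
  have h2 : Even ((n + 1 : ℕ) : ℤ) := by
    rw [Int.even_iff]; push_cast; omega
  exact_mod_cast h2

theorem absRho_act {n : ℕ} {ν lam : Weight n} {w : SignedPerm n}
    (h : act w (ν + rho n) = lam + rho n) (i : Fin n) :
    absRho ν (w.1.symm i) = absRho lam i := by
  have := natAbs_act w (ν + rho n) i
  rw [h] at this
  exact this.symm

theorem kappa_of_conj {n : ℕ} {ν lam μ : Weight n} {w : SignedPerm n}
    (h : act w (ν + rho n) = lam + rho n) :
    kappa ν μ = weylSign w * kappa lam μ := by
  rw [kappa, det_incidence_perm w.1.symm (absRho_act h), Equiv.Perm.sign_symm]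
  rfl

theorem nonnegDominant_twoOmegaLast (n : ℕ) : NonnegDominant (twoOmegaLast n) :=
  ⟨fun _ _ _ => le_rfl, fun _ => by simp [twoOmegaLast]⟩

theorem absRho_twoOmegaPred (n : ℕ) : absRho (twoOmegaPred n) = absRho (twoOmegaLast n) := by
  funext i
  simp only [absRho, twoOmegaPred, twoOmegaLast, rho]
  split_ifs <;> omega

open Classical in
theorem symb_apply {n : ℕ} (R : Type*) [CommRing R] {lam : Weight n}
    (h : NonnegDominant lam ∨ Even n ∧ lam = twoOmegaPred n) (μ : Weight n) :
    symb n R lam μ = if NonnegDominant μ then (kappa lam μ : R) else 0 := by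
  obtain ⟨lam', h1, h2, h3⟩ : ∃ lam', NonnegDominant lam' ∧ absRho lam = absRho lam' ∧
      symb n R lam = Finsupp.single lam' 1 := by
    by_cases hE : Even n ∧ lam = twoOmegaPred n
    · exact ⟨twoOmegaLast n, nonnegDominant_twoOmegaLast n, by rw [hE.2, absRho_twoOmegaPred],
        by rw [symb, if_pos hE]⟩
    · exact ⟨lam, h.resolve_right hE, rfl, by rw [symb, if_neg hE]⟩
  have h4 : kappa lam μ = kappa lam' μ := by rw [kappa, h2, kappa]
  rw [h3, h4, Finsupp.single_apply]
  by_cases hμ : NonnegDominant μ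
  · rw [if_pos hμ, kappa_of_nonnegDominant h1 hμ]; split_ifs <;> simp
  · rw [if_neg hμ, if_neg]; rintro rfl; exact hμ h1

open Classical in
theorem reduced_apply {n k : ℕ} (hk : 2 * k ≤ n) (R : Type*) [CommRing R] {ν : Weight (n + 1)}
    (hν : ν ∈ orbit (wtTwo (n + 1) k)) (μ : Weight (n + 1)) :
    reduced (n + 1) R ν μ = if NonnegDominant μ then (kappa ν μ : R) else 0 := by
  rw [reduced]
  by_cases h : ∃ p : SignedPerm (n + 1) × Weight (n + 1),
      p.1 ∈ weylGroup (n + 1) ∧ Dominant p.2 ∧ act p.1 (ν + rho (n + 1)) = p.2 + rho (n + 1)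
  · obtain ⟨hw, hl, e⟩ := h.choose_spec
    rw [dif_pos h, Finsupp.smul_apply,
      symb_apply R (nonnegDominant_or_eq_twoOmegaPred hk hν hl hw e), kappa_of_conj e]
    split_ifs <;> simp
  · rw [dif_neg h]
    split_ifs with hμ
    · by_contra h0
      refine h (exists_dominant_of_kappa_ne_zero (ν := ν) hμ fun h1 => h0 ?_)
      rw [h1]; simp
    · rfl

end Reduced

/-! ### Orbits of the weights of the recurrences -/

section Orbits

theorem exists_perm_of_card_eq {n : ℕ} {a b : Fin n → ℕ}
    (h : ∀ c, (Finset.univ.filter fun i => a i = c).card =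
      (Finset.univ.filter fun i => b i = c).card) :
    ∃ σ : Equiv.Perm (Fin n), ∀ i, a i = b (σ i) := by
  have e : ∀ c, Nonempty ({i // a i = c} ≃ {i // b i = c}) := fun c =>
    ⟨Fintype.equivOfCardEq (by rw [Fintype.card_subtype, Fintype.card_subtype, h c])⟩
  exact ⟨Equiv.ofFiberEquiv fun c => (e c).some, fun i => (Equiv.ofFiberEquiv_map _ i).symm⟩

/-- The number of coordinates equal to `2` or `-2`. -/
def twos {n : ℕ} (ν : Weight n) : ℕ := ∑ i, if (ν i).natAbs = 2 then 1 else 0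

/-- Weights with coordinates of absolute value at most `2` are conjugated under signed permutations
if they have the same numbers of coordinates `±1` and `±2`. -/
theorem mem_fullOrbit_iff {n : ℕ} {lam : Weight n} (hlam : ∀ i, (lam i).natAbs ≤ 2) {ν : Weight n} :
    ν ∈ fullOrbit lam ↔ (∀ i, (ν i).natAbs ≤ 2) ∧ ones ν = ones lam ∧ twos ν = twos lam := by
  constructor
  · intro h
    refine ⟨fun i => ?_, ?_⟩
    · obtain ⟨σ, hσ⟩ := mem_fullOrbit.1 h
      rw [hσ]; exact hlam _
    · obtain ⟨w, -, rfl⟩ := Finset.mem_image.1 h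
      exact ⟨sum_natAbs_act (fun a => if a = 1 then 1 else 0) w lam,
        sum_natAbs_act (fun a => if a = 2 then 1 else 0) w lam⟩
  · rintro ⟨h0, h1, h2⟩
    refine mem_fullOrbit.2 (exists_perm_of_card_eq (a := fun i => (ν i).natAbs)
      (b := fun i => (lam i).natAbs) fun c => ?_)
    have key : ∀ x : Weight n, (∀ i, (x i).natAbs ≤ 2) →
        (Finset.univ.filter fun i => (x i).natAbs = c).card =
          if c = 0 then n - ones x - twos x else if c = 1 then ones x
            else if c = 2 then twos x else 0 := by
      intro x hx
      have h3 : (Finset.univ.filter fun i => (x i).natAbs = 0).card + ones x + twos x = n := by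
        rw [Finset.card_filter, ones, twos, ← Finset.sum_add_distrib, ← Finset.sum_add_distrib]
        rw [Finset.sum_congr rfl (g := fun _ => 1)]
        · simp
        · intro i _
          have := hx i
          split_ifs <;> omega
      rcases c with _ | _ | _ | c
      · simp only [if_true]; omega
      · simp [ones]
      · simp [twos]
      · rw [if_neg (by omega), if_neg (by omega), if_neg (by omega), Finset.card_eq_zero]
        exact Finset.filter_eq_empty_iff.2 fun i _ => by have := hx i; omega
    rw [key ν h0, key lam hlam, h1, h2]

theorem ones_wtTwo {n k : ℕ} (hk : 2 * k ≤ n) : ones (wtTwo (n + 1) k) = 2 * k := by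
  rw [wtTwo_succ, ones_cons, ones_colWt hk]; simp

theorem twos_wtTwo {n k : ℕ} : twos (wtTwo (n + 1) k) = 1 := by
  rw [wtTwo_succ, twos, Fin.sum_univ_succ, Finset.sum_eq_zero]
  · simp
  · intro i _
    simp only [Fin.cons_succ, colWt]; split_ifs <;> simp_all

theorem twos_colWt {n j : ℕ} : twos (colWt n j) = 0 := by
  refine Finset.sum_eq_zero fun i _ => ?_
  simp only [colWt]; split_ifs <;> simp_all

theorem fullOrbit_wtOne {n k : ℕ} (hk : 2 * k ≤ n) :
    fullOrbit (wtOne n k) = (smallWeights n).filter fun ν => ones ν = 2 * k := by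
  ext ν
  rw [wtOne_eq_colWt, mem_fullOrbit_iff, ones_colWt hk, twos_colWt, Finset.mem_filter, smallWeights,
    Fintype.mem_piFinset]
  · have : (∀ i, ν i ∈ ({-1, 0, 1} : Finset ℤ)) ↔ (∀ i, (ν i).natAbs ≤ 2) ∧ twos ν = 0 := by
      simp only [twos, Finset.sum_eq_zero_iff, Finset.mem_univ, true_imp_iff, ← forall_and,
        Finset.mem_insert, Finset.mem_singleton]
      refine forall_congr' fun i => ?_
      by_cases h : (ν i).natAbs = 2 <;> simp only [h, if_true, if_false, and_true] <;> omega
    rw [this]; tauto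
  · intro i; simp only [colWt]; split_ifs <;> simp

theorem sum_fullOrbit_wtTwo {n k : ℕ} (hk : 2 * k ≤ n) {M : Type*} [AddCommMonoid M]
    (G : Weight (n + 1) → M) : ∑ ν ∈ fullOrbit (wtTwo (n + 1) k), G ν =
      ∑ p, ∑ ν ∈ (weightsAt p).filter (fun ν => ones ν = 2 * k), G ν := by
  have hmem : ∀ (p : Fin (n + 1)) (ν : Weight (n + 1)), ν ∈ weightsAt p ↔
      (ν p).natAbs = 2 ∧ ∀ i ≠ p, (ν i).natAbs ≤ 1 := by
    intro p ν
    rw [weightsAt, Fintype.mem_piFinset]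
    constructor
    · intro h
      refine ⟨?_, fun i hi => ?_⟩
      · have := h p; simp [letters] at this; omega
      · have := h i; simp [letters, hi] at this; omega
    · rintro ⟨h1, h2⟩ i
      by_cases hi : i = p
      · subst hi; simp [letters]; omega
      · have := h2 i hi; simp [letters, hi]; omega
  rw [← Finset.sum_biUnion]
  · refine Finset.sum_congr ?_ fun _ _ => rfl
    ext ν
    rw [mem_fullOrbit_iff, ones_wtTwo hk, twos_wtTwo]
    · simp only [Finset.mem_biUnion, Finset.mem_univ, true_and, Finset.mem_filter, hmem]
      constructor
      · rintro ⟨h0, h1, h2⟩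
        rw [twos, ← Finset.card_filter, Finset.card_eq_one] at h2
        obtain ⟨p, hp⟩ := h2
        have hp' : ∀ i, (ν i).natAbs = 2 ↔ i = p := by
          intro i
          have := congrArg (i ∈ ·) hp
          simpa using this
        refine ⟨p, ⟨(hp' p).2 rfl, fun i hi => ?_⟩, h1⟩
        have h3 := h0 i
        have h4 := (hp' i).not.2 hi
        omega
      · rintro ⟨p, ⟨h1, h2⟩, h3⟩
        refine ⟨fun i => ?_, h3, ?_⟩
        · by_cases hi : i = p
          · subst hi; omega
          · have := h2 i hi; omega
        · rw [twos, Finset.sum_eq_single p, if_pos h1]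
          · intro i _ hi
            have := h2 i hi
            rw [if_neg (by omega)]
          · simp
    · intro i; simp only [wtTwo]; split_ifs <;> simp
  · intro p _ q _ hpq
    rw [Function.onFun, Finset.disjoint_left]
    intro ν h1 h2
    rw [Finset.mem_filter, hmem] at h1 h2
    have := h1.1.1
    have := h2.1.2 p hpq
    omega

/-- The weight `w ω` is determined by `w λ`: only the first coordinate of `λ` is `2`. -/
theorem act_e1 {n k : ℕ} {w : SignedPerm n} {ν : Weight n} (h : act w (wtTwo n k) = ν) :
    act w (e1 n) = halfTwos ν := by
  funext i
  rw [← h]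
  simp only [act, halfTwos, e1, wtTwo]
  rcases Int.units_eq_one_or (w.2 i) with h' | h' <;> rw [h'] <;> split_ifs <;> simp

theorem val_qUnit_zpow (z : ℤ) :
    ((qUnit ^ z : (LaurentPolynomial ℤ)ˣ) : LaurentPolynomial ℤ) = LaurentPolynomial.T z := by
  have h1 : (qUnit : LaurentPolynomial ℤ) = LaurentPolynomial.T 1 := rfl
  have h2 : ((qUnit⁻¹ : (LaurentPolynomial ℤ)ˣ) : LaurentPolynomial ℤ) = LaurentPolynomial.T (-1) :=
    rfl
  rcases z with m | m
  · rw [Int.ofNat_eq_natCast, zpow_natCast, Units.val_pow_eq_pow_val, h1, LaurentPolynomial.T_pow,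
      mul_one]
  · rw [zpow_negSucc, ← inv_pow, Units.val_pow_eq_pow_val, h2, LaurentPolynomial.T_pow]
    congr 1; rw [Int.negSucc_eq]; push_cast; ring

theorem minusculeCoeff_wtTwo {n k : ℕ} {ν : Weight (n + 1)} (hν : ν ∈ orbit (wtTwo (n + 1) k)) :
    minusculeCoeff (-qUnit) (qUnit ^ 2) (wtTwo (n + 1) k) ν = s (rho (n + 1) ⬝ᵥ halfTwos ν) := by
  have himage : ((weylGroup (n + 1)).filter fun w => act w (wtTwo (n + 1) k) = ν).image
      (fun w => act w (e1 (n + 1))) = {halfTwos ν} := by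
    obtain ⟨w, hw, h⟩ := Finset.mem_image.1 hν
    ext ψ
    rw [Finset.mem_image, Finset.mem_singleton]
    constructor
    · rintro ⟨w', hw', rfl⟩
      exact act_e1 (Finset.mem_filter.1 hw').2
    · rintro rfl
      exact ⟨w, Finset.mem_filter.2 ⟨hw, h⟩, act_e1 h⟩
  have hlam : wtTwo (n + 1) k ⬝ᵥ e1 (n + 1) = 2 := by
    rw [dotProduct, Fin.sum_univ_succ, Finset.sum_eq_zero]
    · simp [wtTwo, e1]
    · intro i _; simp [e1]
  have hq : (-qUnit) ^ (2 : ℤ) = qUnit ^ (2 : ℤ) := by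
    rw [← Nat.cast_ofNat, zpow_natCast, zpow_natCast, neg_sq]
  have hT2 : ∀ z : ℤ, (qUnit ^ 2) ^ z = qUnit ^ (2 * z) := by
    intro z; rw [zpow_mul]; rfl
  rw [minusculeCoeff, himage, Finset.sum_singleton, hlam, hq, hT2, hT2, ← zpow_add,
    val_qUnit_zpow, val_qUnit_zpow, s, sub_mul, one_mul, ← LaurentPolynomial.T_add]
  congr 2 <;> ring

end Orbits

/-! ### The recurrences with binomial coefficients -/

section Multiplicity

/-- The number of Weyl group orbits in the orbit of `ω_1 + ω_{2i+1}` in type `D_{N+1}` under signed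
permutations, for `2i ≤ N`. For `0 < N` it is also the corresponding number for `ω_{2i}` in type
`D_N`. -/
def mult (N i : ℕ) : ℕ := if 2 * i < N then 1 else 2

theorem exists_colWt_eq_zero {N j : ℕ} : (∃ i, colWt N j i = 0) ↔ j < N := by
  constructor
  · rintro ⟨i, hi⟩
    by_contra hj
    rw [colWt, if_pos (by omega)] at hi
    exact one_ne_zero hi
  · intro h; exact ⟨⟨j, h⟩, by simp [colWt]⟩

theorem exists_wtTwo_eq_zero {N i : ℕ} : (∃ j, wtTwo (N + 1) i j = 0) ↔ 2 * i < N := by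
  rw [← exists_colWt_eq_zero, wtTwo_succ]
  constructor
  · rintro ⟨j, hj⟩
    induction j using Fin.cases with
    | zero => simp at hj
    | succ j => exact ⟨j, by simpa using hj⟩
  · rintro ⟨j, hj⟩; exact ⟨j.succ, by simpa using hj⟩

theorem coeff_X_pow_mul_one_add_sq {R : Type*} [CommRing R] (N k c : ℕ) :
    ((X : R[X]) ^ c * (1 + X ^ 2) ^ (N - c)).coeff (2 * k) =
      ∑ i ∈ Finset.range (k + 1), if c = 2 * i then ((N - 2 * i).choose (k - i) : R) else 0 := by
  have h : (1 + X ^ 2 : R[X]) ^ (N - c) = expand R 2 ((1 + X) ^ (N - c)) := by simp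
  rw [h, coeff_X_pow_mul']
  split_ifs with hc
  · rw [coeff_expand (by norm_num)]
    split_ifs with hd
    · rw [coeff_one_add_X_pow, Finset.sum_eq_single (c / 2), if_pos (by omega)]
      · rw [show 2 * (c / 2) = c by omega, show (2 * k - c) / 2 = k - c / 2 by omega]
      · intro i _ hi; rw [if_neg (by omega)]
      · intro h'; rw [Finset.mem_range] at h'; omega
    · rw [Finset.sum_eq_zero]
      intro i _; rw [if_neg (by omega)]
  · rw [Finset.sum_eq_zero]
    intro i hi; rw [Finset.mem_range] at hi; rw [if_neg (by omega)]

end Multiplicity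

section Recurrence

theorem s_neg (z : ℤ) : s (-z) = -s (z - 1) := by
  simp only [s, sub_mul, one_mul, ← LaurentPolynomial.T_add]
  rw [neg_sub]; congr 2 <;> ring

open Classical in
theorem recTwo_apply {N k : ℕ} (hk : 2 * k ≤ N) (μ : Weight (N + 1)) :
    recTwo (N + 1) k μ = if NonnegDominant μ then
      ∑ ν ∈ orbit (wtTwo (N + 1) k),
        s (rho (N + 1) ⬝ᵥ halfTwos ν) * (kappa ν μ : LaurentPolynomial ℤ)
      else 0 := by
  rw [recTwo, minusculeRecurrence, Finsupp.finsetSum_apply]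
  split_ifs with hμ
  · refine Finset.sum_congr rfl fun ν hν => ?_
    rw [Finsupp.smul_apply, reduced_apply hk _ hν, if_pos hμ, minusculeCoeff_wtTwo hν, smul_eq_mul]
  · refine Finset.sum_eq_zero fun ν hν => ?_
    rw [Finsupp.smul_apply, reduced_apply hk _ hν, if_neg hμ, smul_zero]

theorem rho_dotProduct_halfTwos_flipLast {N : ℕ} (ν : Weight (N + 1)) :
    rho (N + 1) ⬝ᵥ halfTwos (flipLast ν) = rho (N + 1) ⬝ᵥ halfTwos ν := by
  rw [dotProduct, dotProduct, Fin.sum_univ_castSucc, Fin.sum_univ_castSucc, rho_last]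
  simp [halfTwos, flipLast, Fin.castSucc_ne_last]

/-- The combination of the recurrences with binomial coefficients is the coefficient of `v ^ (2k)`
in the sum of all products in which one factor `mulGen v m` is replaced by `shiftGen s m`. -/
theorem sum_choose_mul_recTwo {N k : ℕ} (hk : 2 * k ≤ N) {μ : Weight (N + 1)}
    (hμ : NonnegDominant μ) :
    ∑ i ∈ Finset.range (k + 1), ((N - 2 * i).choose (k - i) : LaurentPolynomial ℤ) *
        (mult N i * recTwo (N + 1) i μ) =
      (coordFunctional _ μ (shiftSum (X : (LaurentPolynomial ℤ)[X])
        (fun i => C (s i)) (N + 1))).coeff (2 * k) := by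
  classical
  have h1 : ∀ i ∈ Finset.range (k + 1), (mult N i * recTwo (N + 1) i μ : LaurentPolynomial ℤ) =
      ∑ p, ∑ ν ∈ weightsAt p, if ones ν = 2 * i then
        s (rho (N + 1) ⬝ᵥ halfTwos ν) * (kappa ν μ : LaurentPolynomial ℤ) else 0 := by
    intro i hi
    rw [Finset.mem_range] at hi
    have hi' : 2 * i ≤ N := by omega
    simp only [← Finset.sum_filter]
    rw [← sum_fullOrbit_wtTwo hi' fun ν =>
        s (rho (N + 1) ⬝ᵥ halfTwos ν) * (kappa ν μ : LaurentPolynomial ℤ), sum_fullOrbit,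
      recTwo_apply hi', if_pos hμ, nsmul_eq_mul]
    · simp only [exists_wtTwo_eq_zero, mult]
    · intro ν; rw [rho_dotProduct_halfTwos_flipLast, kappa_flipLast]
  rw [Finset.sum_congr rfl fun i hi => by rw [h1 i hi],
    shiftSum_eq_sum X (fun z => C (s z)) (fun z => by rw [s_neg, C_neg])]
  simp only [map_sum, map_smul, finsetSum_coeff, Finset.mul_sum]
  rw [Finset.sum_comm]
  refine Finset.sum_congr rfl fun p _ => ?_
  rw [Finset.sum_comm]
  refine Finset.sum_congr rfl fun ν hν => ?_
  rw [coordFunctional_weightWedge, prod_letterCoeff _ _ hν, smul_eq_mul, ← C_eq_intCast,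
    coeff_mul_C, coeff_C_mul, Nat.add_sub_cancel, coeff_X_pow_mul_one_add_sq, Finset.mul_sum,
    Finset.sum_mul]
  refine Finset.sum_congr rfl fun i _ => ?_
  split_ifs <;> ring

theorem coeff_shift_formula {N k : ℕ} {μ : Weight (N + 1)}
    (hμ : NonnegDominant μ) :
    (coordFunctional _ μ (shiftSum (X : (LaurentPolynomial ℤ)[X])
        (fun i => C (s i)) (N + 1))).coeff (2 * k) =
      (∑ j ∈ Finset.range (N + 2), if colWt (N + 1) j = μ then
        (shiftCoeff (X : (LaurentPolynomial ℤ)[X]) (fun i => C (s i)) N j).coeff (2 * k) else 0) +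
      s N * ∑ j ∈ Finset.range (N + 1), if (Fin.cons 2 (colWt N j) : Weight (N + 1)) = μ then
          (if 2 * k = j then 1 else 0) + (if 2 * k = 2 * N - j then 1 else 0) else 0 := by
  rw [coordFunctional_shiftSum _ _ hμ, coeff_add, coeff_C_mul, finsetSum_coeff, finsetSum_coeff]
  refine congrArg₂ (· + ·) ?_ (congrArg _ ?_)
  · refine Finset.sum_congr rfl fun j _ => ?_
    by_cases h : colWt (N + 1) j = μ
    · rw [if_pos h, if_pos h]
    · rw [if_neg h, if_neg h, coeff_zero]
  · refine Finset.sum_congr rfl fun j _ => ?_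
    by_cases h : (Fin.cons 2 (colWt N j) : Weight (N + 1)) = μ
    · rw [if_pos h, if_pos h, coeff_add, coeff_X_pow, coeff_X_pow]
    · rw [if_neg h, if_neg h, coeff_zero]

end Recurrence

/-! ### The numbers `E` and `Θ` -/

section Numbers

/-- A weight in the orbit of `ω_{2i}` which is conjugated to `ω_{2h}` has the sign
`(-1) ^ (i - h)`. -/
theorem kappa_small_wtOne {N i h : ℕ} (hi : 2 * i ≤ N) (hh : 2 * h ≤ N) {ν : Weight N}
    (hν : ν ∈ fullOrbit (wtOne N i)) (h0 : kappa ν (wtOne N h) ≠ 0) :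
    h ≤ i ∧ kappa ν (wtOne N h) = (-1) ^ (i - h) := by
  rw [fullOrbit_wtOne hi, Finset.mem_filter] at hν
  have hk : kappa ν (wtOne N h) = coordFunctional ℤ (wtOne N h) (weightWedge ℤ ν) := by
    rw [coordFunctional_weightWedge]; simp
  rcases weightWedge_small (B := ℤ) hν.1 with hw | ⟨j, r, h1, h2, h3⟩
  · rw [hk, hw, map_zero] at h0; exact absurd rfl h0
  · have h4 : kappa ν (wtOne N h) = (-1) ^ r * if colWt N j = wtOne N h then 1 else 0 := by
      rw [hk, h3, map_smul, wtOne_eq_colWt,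
        coordFunctional_missWedge h2 (nonnegDominant_colWt N (2 * h)), smul_eq_mul]
    split_ifs at h4 with h5
    · have := colWt_injOn h2 hh h5
      exact ⟨by omega, by rw [h4, mul_one]; congr 1; omega⟩
    · rw [h4, mul_zero] at h0; exact absurd rfl h0

theorem conjugated_wtOne_iff {N h : ℕ} (hh : 2 * h < N + 1) {ν : Weight (N + 1)} :
    Conjugated ν (wtOne (N + 1) h) ↔ kappa ν (wtOne (N + 1) h) ≠ 0 := by
  have hnn := nonnegDominant_colWt (N + 1) (2 * h)
  constructor
  · rintro ⟨w, -, e⟩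
    rw [kappa_of_conj e, wtOne_eq_colWt, kappa_of_nonnegDominant hnn hnn, if_pos rfl, mul_one,
      weylSign]
    exact Units.ne_zero _
  · intro h0
    obtain ⟨σ, hσ⟩ := exists_perm_of_det_incidence_ne_zero h0
    have hlast : (wtOne (N + 1) h + rho (N + 1)) (Fin.last N) = 0 := by
      rw [Pi.add_apply, rho_last, wtOne, if_neg (by rw [Fin.val_last]; omega), add_zero]
    have hlast' : (ν + rho (N + 1)) (σ (Fin.last N)) = 0 := by
      have h1 : ((ν + rho (N + 1)) (σ (Fin.last N))).natAbs =
        ((wtOne (N + 1) h + rho (N + 1)) (Fin.last N)).natAbs := hσ _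
      rw [hlast] at h1; omega
    obtain ⟨w, hw, -, e⟩ := exists_mem_weylGroup σ.symm (x := ν + rho (N + 1))
      (y := wtOne (N + 1) h + rho (N + 1)) (fun i => (hσ i).symm)
      (by rw [Finset.prod_eq_zero (Finset.mem_univ _) hlast,
        Finset.prod_eq_zero (Finset.mem_univ _) hlast'])
    exact ⟨w, hw, e⟩

/-- `Θ(N,i,h)` is, up to the sign `(-1) ^ (i - h)`, the coefficient of `C_{h,N}` in the sum of all
`C_ν` over the orbit of `ω_{2i}`. -/
theorem sum_kappa_fullOrbit_wtOne {N i h : ℕ} (hi : 2 * i ≤ N + 1) (hh : 2 * h < N + 1) :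
    ∑ ν ∈ fullOrbit (wtOne (N + 1) i), kappa ν (wtOne (N + 1) h) =
      if h ≤ i then (mult (N + 1) i : ℤ) * ((-1) ^ (i - h) * (Theta (N + 1) i h : ℤ)) else 0 := by
  classical
  rw [sum_fullOrbit _ _ (fun ν => kappa_flipLast ν _), nsmul_eq_mul]
  have h1 : ∀ ν ∈ orbit (wtOne (N + 1) i), kappa ν (wtOne (N + 1) h) =
      if h ≤ i then if Conjugated ν (wtOne (N + 1) h) then (-1) ^ (i - h) else 0 else 0 := by
    intro ν hν
    by_cases h0 : kappa ν (wtOne (N + 1) h) = 0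
    · rw [if_neg (c := Conjugated _ _) (by rw [conjugated_wtOne_iff hh]; exact not_not.2 h0), h0]
      simp
    · obtain ⟨h2, h3⟩ := kappa_small_wtOne hi hh.le (mem_orbit.1 hν).1 h0
      rw [if_pos h2, if_pos ((conjugated_wtOne_iff hh).2 h0), h3]
  have h2 : (if ∃ j, wtOne (N + 1) i j = 0 then 1 else 2) = mult (N + 1) i := by
    rw [wtOne_eq_colWt]; simp only [exists_colWt_eq_zero, mult]
  rw [Finset.sum_congr rfl h1, h2]
  by_cases h3 : h ≤ i
  · simp only [if_pos h3]
    rw [← Finset.sum_filter, Finset.sum_const, nsmul_eq_mul, mul_comm _ ((-1 : ℤ) ^ (i - h)),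
      Theta, Omega]
  · simp [h3]

/-- The binomial coefficients satisfy, up to normalization, the relation which defines the numbers
`E`. The left-hand side is the coefficient of `C_{h,N+1}` in the exterior power of degree `2k`,
which is represented by the symbol `C_{k,N+1}` alone. -/
theorem sum_choose_mul_Theta {N k h : ℕ} (hk : 2 * k ≤ N + 1) (hh : 2 * h < N + 1) :
    ∑ i ∈ Finset.Icc h k, ((N + 1 - 2 * i).choose (k - i) : ℤ) *
      (mult (N + 1) i * ((-1) ^ (i - h) * Theta (N + 1) i h)) = if h = k then 1 else 0 := by
  have h1 : (coordFunctional ℤ[X] (wtOne (N + 1) h) (mulProd (X : ℤ[X]) (N + 1))).coeff (2 * k) =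
      if h = k then 1 else 0 := by
    rw [mulProd_succ, wtOne_eq_colWt, coordFunctional_extSum _ (nonnegDominant_colWt _ _),
      Finset.sum_eq_single (2 * h), if_pos rfl, coeff_add, coeff_X_pow, coeff_X_pow,
      if_neg (show ¬2 * k = 2 * (N + 1) - 2 * h by omega), add_zero]
    · exact if_congr (by omega) rfl rfl
    · intro j hj hne
      rw [Finset.mem_range] at hj
      exact if_neg fun h' => hne (colWt_injOn (by omega) (by omega) h')
    · intro h'; rw [Finset.mem_range] at h'; omega
  rw [← h1, mulProd_eq_sum]
  simp only [map_sum, map_smul, finsetSum_coeff]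
  have h2 : ∀ ν ∈ smallWeights (N + 1), ((∏ i, smallCoeff (X : ℤ[X]) (ν i)) •
      coordFunctional ℤ[X] (wtOne (N + 1) h) (weightWedge ℤ[X] ν)).coeff (2 * k) =
        ∑ i ∈ Finset.range (k + 1), ((N + 1 - 2 * i).choose (k - i) : ℤ) *
          if ones ν = 2 * i then kappa ν (wtOne (N + 1) h) else 0 := by
    intro ν hν
    rw [coordFunctional_weightWedge, prod_smallCoeff _ hν, smul_eq_mul, ← C_eq_intCast,
      coeff_mul_C, coeff_X_pow_mul_one_add_sq, Finset.sum_mul]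
    refine Finset.sum_congr rfl fun i _ => ?_
    split_ifs <;> simp
  rw [Finset.sum_congr rfl h2, Finset.sum_comm]
  have h3 : ∀ i ∈ Finset.range (k + 1), (∑ ν ∈ smallWeights (N + 1),
      ((N + 1 - 2 * i).choose (k - i) : ℤ) *
        if ones ν = 2 * i then kappa ν (wtOne (N + 1) h) else 0) =
      if h ≤ i then ((N + 1 - 2 * i).choose (k - i) : ℤ) *
        (mult (N + 1) i * ((-1) ^ (i - h) * Theta (N + 1) i h)) else 0 := by
    intro i hi
    rw [Finset.mem_range] at hi
    rw [← Finset.mul_sum, ← Finset.sum_filter, ← fullOrbit_wtOne (by omega),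
      sum_kappa_fullOrbit_wtOne (by omega) hh]
    split_ifs <;> simp
  rw [Finset.sum_congr rfl h3, ← Finset.sum_filter]
  refine Finset.sum_congr ?_ fun _ _ => rfl
  ext i; simp only [Finset.mem_Icc, Finset.mem_filter, Finset.mem_range]; omega

/-- The case `k = h` of the relation between `Θ` and the binomial coefficients. -/
theorem Phi_self {N h : ℕ} (hh : 2 * h < N) : Phi (N + 1) h h = 1 := by
  obtain ⟨N, rfl⟩ : ∃ m, N = m + 1 := ⟨N - 1, by omega⟩
  have := sum_choose_mul_Theta (N := N) (k := h) hh.le hh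
  rw [Finset.Icc_self, Finset.sum_singleton, if_pos rfl, mult, if_pos hh] at this
  simp only [Nat.sub_self, pow_zero, Nat.choose_zero_right, Nat.cast_one, one_mul] at this
  exact_mod_cast this

theorem E_self (n k : ℕ) : E n k k = 1 := by rw [E, if_neg (lt_irrefl k), if_pos rfl]

theorem E_of_lt {n k h : ℕ} (hk : h < k) : E n k h =
    -∑ i ∈ Finset.Icc (h + 1) k, (-1) ^ (i - h) * (Phi n i h : ℤ) * E n k i := by
  rw [E, if_neg hk.not_gt, if_neg hk.ne,
    Finset.sum_coe_sort (Finset.Icc (h + 1) k) fun i => (-1) ^ (i - h) * (Phi n i h : ℤ) * E n k i]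

theorem sum_Phi_mul_E {N k h : ℕ} (hk : h < k) (hN : 2 * k ≤ N) :
    ∑ i ∈ Finset.Icc h k, (-1 : ℤ) ^ (i - h) * (Phi (N + 1) i h : ℤ) * E (N + 1) k i = 0 := by
  rw [← Finset.add_sum_Ioc_eq_sum_Icc hk.le, ← Finset.Icc_add_one_left_eq_Ioc, E_of_lt hk,
    Phi_self (by omega)]
  simp

/-- The closed form of the numbers `E`. -/
theorem mult_mul_E {N k i : ℕ} (hN : 2 * k ≤ N) (hi : i ≤ k) :
    (mult N k : ℤ) * E (N + 1) k i = mult N i * ((N - 2 * i).choose (k - i) : ℤ) := by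
  induction hd : k - i using Nat.strong_induction_on generalizing i with
  | _ d ih =>
    subst hd
    rcases hi.lt_or_eq with hlt | rfl
    · obtain ⟨N, rfl⟩ : ∃ m, N = m + 1 := ⟨N - 1, by omega⟩
      have h1 := sum_choose_mul_Theta (N := N) (k := k) (h := i) hN (by omega)
      rw [if_neg hlt.ne, ← Finset.add_sum_Ioc_eq_sum_Icc hi, ← Finset.Icc_add_one_left_eq_Ioc] at h1
      have h2 : (Theta (N + 1) i i : ℤ) = 1 := by
        exact_mod_cast Phi_self (N := N + 1) (h := i) (by omega)
      rw [h2, Nat.sub_self, pow_zero, mul_one, mul_one] at h1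
      rw [E_of_lt hlt, mul_neg, Finset.mul_sum, mul_comm (mult (N + 1) i : ℤ),
        eq_neg_of_add_eq_zero_left h1]
      congr 1
      refine Finset.sum_congr rfl fun j hj => ?_
      rw [Finset.mem_Icc] at hj
      rw [mul_left_comm, ih (k - j) (by omega) hj.2 rfl, Phi, Nat.add_sub_cancel]
      ring
    · simp [E_self]

end Numbers

/-! ### The combination of the recurrences -/

section Final

theorem combination_apply (n k : ℕ) (μ : Weight n) :
    combination n k μ = ∑ i ∈ Finset.range (k + 1), (E n k i : LaurentPolynomial ℤ) *
      recTwo n i μ := by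
  rw [combination, Finsupp.finsetSum_apply]
  refine Finset.sum_congr rfl fun i _ => ?_
  rw [Finsupp.smul_apply, zsmul_eq_mul]

theorem combination_apply_of_not_nonnegDominant {N k : ℕ} (hk : 2 * k ≤ N) {μ : Weight (N + 1)}
    (hμ : ¬NonnegDominant μ) : combination (N + 1) k μ = 0 := by
  rw [combination_apply]
  refine Finset.sum_eq_zero fun i hi => ?_
  rw [Finset.mem_range] at hi
  rw [recTwo_apply (by omega), if_neg hμ, mul_zero]

/-- The coefficients of the combination `∑ E_i R_i`, in closed form. -/
theorem mult_mul_combination_apply {N k : ℕ} (hk : 2 * k ≤ N) {μ : Weight (N + 1)}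
    (hμ : NonnegDominant μ) : (mult N k : LaurentPolynomial ℤ) * combination (N + 1) k μ =
      (∑ j ∈ Finset.range (N + 2), if colWt (N + 1) j = μ then
        (shiftCoeff (X : (LaurentPolynomial ℤ)[X]) (fun i => C (s i)) N j).coeff (2 * k) else 0) +
      s N * ∑ j ∈ Finset.range (N + 1), if (Fin.cons 2 (colWt N j) : Weight (N + 1)) = μ then
          (if 2 * k = j then 1 else 0) + (if 2 * k = 2 * N - j then 1 else 0) else 0 := by
  rw [← coeff_shift_formula hμ, ← sum_choose_mul_recTwo hk hμ, combination_apply, Finset.mul_sum]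
  refine Finset.sum_congr rfl fun i hi => ?_
  rw [Finset.mem_range] at hi
  have h := congrArg (Int.cast : ℤ → LaurentPolynomial ℤ) (mult_mul_E hk (i := i) (by omega))
  push_cast at h
  rw [← mul_assoc, h]; ring

theorem charZero_laurentPolynomial : CharZero (LaurentPolynomial ℤ) :=
  charZero_of_injective_ringHom (f := (toLaurent : ℤ[X] →+* LaurentPolynomial ℤ))
    toLaurent_injective

theorem mult_ne_zero (N k : ℕ) : (mult N k : LaurentPolynomial ℤ) ≠ 0 := by
  have := charZero_laurentPolynomial
  rw [mult]; split_ifs <;> norm_num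

theorem cons_two_ne_colWt {N i j : ℕ} :
    (Fin.cons 2 (colWt N i) : Weight (N + 1)) ≠ colWt (N + 1) j := by
  intro h
  have := congrFun h 0
  simp only [Fin.cons_zero, colWt] at this
  split_ifs at this <;> omega

theorem mult_mul_combination_colWt {N k j : ℕ} (hk : 2 * k ≤ N) (hj : j ≤ N + 1) :
    (mult N k : LaurentPolynomial ℤ) * combination (N + 1) k (colWt (N + 1) j) =
      (shiftCoeff (X : (LaurentPolynomial ℤ)[X]) (fun i => C (s i)) N j).coeff (2 * k) := by
  rw [mult_mul_combination_apply hk (nonnegDominant_colWt _ _), Finset.sum_eq_single j, if_pos rfl,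
    Finset.sum_eq_zero, mul_zero, add_zero]
  · intro i _; exact if_neg cons_two_ne_colWt
  · intro i hi hij
    rw [Finset.mem_range] at hi
    exact if_neg fun h => hij (colWt_injOn (by omega) hj h)
  · intro h; rw [Finset.mem_range] at h; omega

/-- The coefficient of this symbol is a multiple of the coefficient of `v ^ (2k)` in
`v ^ j + v ^ (2N - j)`, which vanishes for `j ≤ N`, `2k ≤ N` and `j ≠ 2k`. -/
theorem combination_cons_two {N k j : ℕ} (hk : 2 * k ≤ N) (hj : j ≤ N) (hjk : j ≠ 2 * k) :
    combination (N + 1) k (Fin.cons 2 (colWt N j)) = 0 := by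
  have h := mult_mul_combination_apply hk (nonnegDominant_cons_two N j)
  rw [Finset.sum_eq_zero, Finset.sum_eq_zero, mul_zero, add_zero] at h
  · exact (mul_eq_zero.1 h).resolve_left (mult_ne_zero N k)
  · intro i hi
    rw [Finset.mem_range] at hi
    refine ite_eq_right_iff.2 fun h' => ?_
    have := colWt_injOn (by omega) hj (Fin.cons_inj.1 h').2
    rw [if_neg (by omega), if_neg (by omega), add_zero]
  · intro i _; exact if_neg cons_two_ne_colWt.symm

theorem combination_apply_of_ne {N k : ℕ} (hk : 2 * k ≤ N) {μ : Weight (N + 1)}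
    (h1 : ∀ h, 2 * h ≤ N + 1 → wtOne (N + 1) h ≠ μ) (h2 : wtTwo (N + 1) k ≠ μ) :
    combination (N + 1) k μ = 0 := by
  by_cases hμ : NonnegDominant μ
  swap
  · exact combination_apply_of_not_nonnegDominant hk hμ
  by_cases h3 : ∃ j ≤ N + 1, colWt (N + 1) j = μ
  · obtain ⟨j, hj, rfl⟩ := h3
    have := mult_mul_combination_colWt hk hj
    rw [coeff_shiftCoeff_of_odd _ hj] at this
    · exact (mul_eq_zero.1 this).resolve_left (mult_ne_zero N k)
    · have h4 : Odd j := by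
        by_contra hc
        obtain ⟨h, rfl⟩ := Nat.not_odd_iff_even.1 hc
        exact h1 h (by omega) (by rw [wtOne_eq_colWt, two_mul])
      exact (even_two_mul k).add_odd h4
  by_cases h4 : ∃ j ≤ N, (Fin.cons 2 (colWt N j) : Weight (N + 1)) = μ
  · obtain ⟨j, hj, rfl⟩ := h4
    refine combination_cons_two hk hj ?_
    rintro rfl
    exact h2 (wtTwo_succ N k)
  · have h := mult_mul_combination_apply hk hμ
    rw [Finset.sum_eq_zero, Finset.sum_eq_zero, mul_zero, add_zero] at h
    · exact (mul_eq_zero.1 h).resolve_left (mult_ne_zero N k)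
    · intro i hi
      rw [Finset.mem_range] at hi
      exact if_neg fun h' => h4 ⟨i, by omega, h'⟩
    · intro i hi
      rw [Finset.mem_range] at hi
      exact if_neg fun h' => h3 ⟨i, by omega, h'⟩

theorem combination_wtTwo_of_ne {N k h : ℕ} (hk : 2 * k ≤ N) (hh : 2 * h ≤ N) (hne : h ≠ k) :
    combination (N + 1) k (wtTwo (N + 1) h) = 0 := by
  rw [wtTwo_succ]; exact combination_cons_two hk hh (by omega)

/-- `C_{2|h,n}` does not occur in `R_k` for `k < h`: otherwise, for the least such `k`, it would
occur in the combination `∑ E_i R_i`, in which `R_k` has the coefficient `1`. -/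
theorem recTwo_wtTwo_of_lt {N k h : ℕ} (hh : 2 * h ≤ N) (hkh : k < h) :
    recTwo (N + 1) k (wtTwo (N + 1) h) = 0 := by
  induction k using Nat.strong_induction_on with
  | _ k ih =>
    have h1 := combination_wtTwo_of_ne (N := N) (k := k) (by omega) hh hkh.ne'
    rw [combination_apply, Finset.sum_range_succ, Finset.sum_eq_zero, E_self] at h1
    · simpa using h1
    · intro i hi
      rw [Finset.mem_range] at hi
      rw [ih i hi (by omega), mul_zero]

theorem combination_wtTwo_self {N k : ℕ} (hk : 2 * k ≤ N) :
    combination (N + 1) k (wtTwo (N + 1) k) = LambdaTwo (N + 1) k k := by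
  rw [combination_apply, Finset.sum_range_succ, Finset.sum_eq_zero, E_self, LambdaTwo]
  · simp
  · intro i hi
    rw [Finset.mem_range] at hi
    rw [recTwo_wtTwo_of_lt hk hi, mul_zero]

theorem mult_mul_combination_wtOne_of_lt {N k h : ℕ} (hk : 2 * k ≤ N) (hh : h < k) :
    (mult N k : LaurentPolynomial ℤ) * combination (N + 1) k (wtOne (N + 1) h) =
      -(s ((k - h : ℕ) : ℤ) + s ((N - k - h : ℕ) : ℤ)) := by
  rw [wtOne_eq_colWt, mult_mul_combination_colWt hk (by omega),
    coeff_shiftCoeff_of_lt (fun i => s i) hh hk]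

theorem combination_wtOne_of_gt {N k h : ℕ} (hk : 2 * k ≤ N) (hh : k + 1 < h)
    (hN : 2 * h ≤ N + 1) : combination (N + 1) k (wtOne (N + 1) h) = 0 := by
  have h1 := mult_mul_combination_colWt hk hN
  rw [coeff_shiftCoeff_of_gt (fun i => s i) hh hN] at h1
  exact (mul_eq_zero.1 h1).resolve_left (mult_ne_zero N k)

/-- The identification of `C_{2ω_{n-1}}` with `C_{2ω_n}` is trivial on nonnegative weights. -/
theorem symb_of_nonnegDominant {N : ℕ} (R : Type*) [CommRing R] {μ : Weight (N + 1)}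
    (hμ : NonnegDominant μ) : symb (N + 1) R μ = Finsupp.single μ 1 := by
  rw [symb, if_neg]
  rintro ⟨-, rfl⟩
  have := hμ.2 (Fin.last N)
  simp [twoOmegaPred] at this

theorem COne_eq (N h : ℕ) : COne (N + 1) h = Finsupp.single (wtOne (N + 1) h) 1 :=
  symb_of_nonnegDominant _ (nonnegDominant_colWt _ _)

theorem CTwo_eq (N h : ℕ) : CTwo (N + 1) h = Finsupp.single (wtTwo (N + 1) h) 1 :=
  symb_of_nonnegDominant _ (wtTwo_succ N h ▸ nonnegDominant_cons_two _ _)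

/-- The symbols occurring in the combination are `C_{2|k,n}` and `C_{h,n}` with `h ≤ k + 1`. -/
theorem combination_eq_sum {N k : ℕ} (hk : 2 * k ≤ N) :
    combination (N + 1) k = LambdaTwo (N + 1) k k • CTwo (N + 1) k +
      ∑ h ∈ (Finset.range (k + 2)).filter (fun h => 2 * h ≤ N + 1),
        GammaOne (N + 1) k h • COne (N + 1) h := by
  have hne : ∀ h, wtTwo (N + 1) k ≠ wtOne (N + 1) h := fun h => by
    rw [wtTwo_succ]; exact cons_two_ne_colWt
  ext1 μ
  simp only [Finsupp.add_apply, Finsupp.finsetSum_apply, Finsupp.smul_apply, COne_eq, CTwo_eq,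
    Finsupp.single_apply, smul_eq_mul, mul_ite, mul_one, mul_zero]
  by_cases h2 : wtTwo (N + 1) k = μ
  · subst h2
    rw [if_pos rfl, combination_wtTwo_self hk, Finset.sum_eq_zero, add_zero]
    intro h _; exact if_neg (hne h).symm
  rw [if_neg h2, zero_add]
  by_cases h1 : ∃ h, 2 * h ≤ N + 1 ∧ wtOne (N + 1) h = μ
  · obtain ⟨h, hh, rfl⟩ := h1
    rw [← GammaOne]
    by_cases hhk : h < k + 2
    · rw [Finset.sum_eq_single h, if_pos rfl]
      · intro i hi hne'
        rw [Finset.mem_filter] at hi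
        refine if_neg fun h' => hne' ?_
        have := colWt_injOn hi.2 hh h'
        omega
      · intro h'; exact absurd (Finset.mem_filter.2 ⟨Finset.mem_range.2 hhk, hh⟩) h'
    · rw [GammaOne, combination_wtOne_of_gt hk (by omega) hh, Finset.sum_eq_zero]
      intro i hi
      rw [Finset.mem_filter, Finset.mem_range] at hi
      refine if_neg fun h' => ?_
      have := colWt_injOn hi.2 hh h'
      omega
  · rw [combination_apply_of_ne hk (fun h hh h' => h1 ⟨h, hh, h'⟩) h2, Finset.sum_eq_zero]
    intro h hh
    exact if_neg fun h' => h1 ⟨h, (Finset.mem_filter.1 hh).2, h'⟩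

end Final
end TypeD

theorem mainTheorem3 (n k : ℕ) (hkn : 2 * k + 1 ≤ n) :
    TypeD.E n k k = 1 ∧
    (∀ h < k, ∑ i ∈ Finset.Icc h k,
      (-1 : ℤ) ^ (i - h) * (TypeD.Phi n i h : ℤ) * TypeD.E n k i = 0) ∧
    (∀ h < k, TypeD.GammaTwo n k h = 0) ∧
    (n = 2 * k + 1 →
      TypeD.combination n k =
        TypeD.LambdaTwo n k k • TypeD.CTwo n k
        + TypeD.GammaOne n k k • TypeD.COne n k
        - ∑ j ∈ Finset.range k, TypeD.s ((k : ℤ) - j) • TypeD.COne n j) ∧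
    (2 * k + 1 < n →
      TypeD.combination n k =
        TypeD.LambdaTwo n k k • TypeD.CTwo n k
        + TypeD.GammaOne n k (k + 1) • TypeD.COne n (k + 1)
        + TypeD.GammaOne n k k • TypeD.COne n k
        - ∑ j ∈ Finset.range k, TypeD.d ((k : ℤ) - j) ((n : ℤ) - 2 * j) • TypeD.COne n j) := by
  obtain ⟨N, rfl⟩ : ∃ N, n = N + 1 := ⟨n - 1, by omega⟩
  have hk : 2 * k ≤ N := by omega
  refine ⟨TypeD.E_self _ _, fun h hh => TypeD.sum_Phi_mul_E hh hk,
    fun h hh => TypeD.combination_wtTwo_of_ne hk (by omega) hh.ne, fun hn => ?_, fun hn => ?_⟩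
  · have hfilter : (Finset.range (k + 2)).filter (fun h => 2 * h ≤ N + 1) =
        Finset.range (k + 1) := by
      ext h; simp only [Finset.mem_filter, Finset.mem_range]; omega
    rw [TypeD.combination_eq_sum hk, hfilter, Finset.sum_range_succ]
    have h2 : ∑ j ∈ Finset.range k, TypeD.GammaOne (N + 1) k j • TypeD.COne (N + 1) j =
        -∑ j ∈ Finset.range k, TypeD.s ((k : ℤ) - j) • TypeD.COne (N + 1) j := by
      rw [← Finset.sum_neg_distrib]
      refine Finset.sum_congr rfl fun j hj => ?_
      rw [Finset.mem_range] at hj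
      rw [← neg_smul]
      congr 1
      have h1 := TypeD.mult_mul_combination_wtOne_of_lt hk hj
      rw [TypeD.mult, if_neg (by omega), show N - k - j = k - j by omega, ← two_mul,
        ← mul_neg, Nat.cast_sub hj.le, Nat.cast_ofNat] at h1
      have := TypeD.charZero_laurentPolynomial
      exact mul_left_cancel₀ two_ne_zero h1
    rw [h2]
    abel
  · have hfilter : (Finset.range (k + 2)).filter (fun h => 2 * h ≤ N + 1) =
        Finset.range (k + 2) := by
      ext h; simp only [Finset.mem_filter, Finset.mem_range]; omega
    rw [TypeD.combination_eq_sum hk, hfilter, Finset.sum_range_succ, Finset.sum_range_succ]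
    have h2 : ∑ j ∈ Finset.range k, TypeD.GammaOne (N + 1) k j • TypeD.COne (N + 1) j =
        -∑ j ∈ Finset.range k,
          TypeD.d ((k : ℤ) - j) (((N + 1 : ℕ) : ℤ) - 2 * j) • TypeD.COne (N + 1) j := by
      rw [← Finset.sum_neg_distrib]
      refine Finset.sum_congr rfl fun j hj => ?_
      rw [Finset.mem_range] at hj
      rw [← neg_smul]
      congr 1
      have h1 := TypeD.mult_mul_combination_wtOne_of_lt hk hj
      rw [TypeD.mult, if_pos (by omega), Nat.cast_one, one_mul] at h1
      rw [TypeD.GammaOne, h1, TypeD.d, Nat.cast_sub hj.le]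
      congr 4
      push_cast [show k ≤ N by omega, show j ≤ N - k by omega]
      ring
    rw [h2]
    abel
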